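/- Let $n\ge 1$, let $M\subset\mathbb{R}^n$ be compact with the Euclidean distance $d$, and let $m$ be a Borel probability measure on $M$ that is absolutely continuous with respect to Lebesgue measure, has topological support $M$, and satisfies a Poincaré inequality: there is $c>0$ with $\int_M|\nabla u|^2\,dm\ge c\int_M u^2\,dm$ for all Lipschitz $u:\mathbb{R}^n\to\mathbb{R}$ with $\int_M u\,dm=0$. Let $\mathcal{P}(M)$ be the space of Borel probability measures on $M$. A function $\varphi:M\to\mathbb{R}$ is called $d^2/2$-convex if $\varphi=\psi^{\mathfrak c}$ for some $\psi:M\to\mathbb{R}$, where $\psi^{\mathfrak c}(x)=-\inf_{y\in M}\left[\tfrac12 d^2(x,y)+\psi(y)\right]$. For $\mu\in\mathcal{P}(M)$ there is a $d^2/2$-convex $\varphi$, unique up to additive constants, with $(\mathrm{Id}+\nabla\varphi)_*m=\mu$; the conjugate measure of $\mu$ is $\mu^{\mathfrak c}=(\mathrm{Id}+\nabla\varphi^{\mathfrak c})_*m$. For $\beta>0$ let $\mathbb{Q}^\beta$ be the Dirichlet--Ferguson process on $M$ with intensity measure $\beta m$, i.e. the probability measure on $\mathcal{P}(M)$ under which,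 for every finite measurable partition $M=M_1\,\dot\cup\cdots\dot\cup\,M_N$ into sets of positive $m$-measure, the vector $(\nu(M_1),\dots,\nu(M_N))$ has the Dirichlet distribution with parameters $(\beta m(M_1),\dots,\beta m(M_N))$. Let $\mathbb{P}^\beta$ be the image of $\mathbb{Q}^\beta$ under the map $\nu\mapsto\nu^{\mathfrak c}$. Then $\mathbb{P}^\beta$ is a probability measure on $\mathcal{P}(M)$, and $\mathbb{P}^\beta$-almost every $\mu\in\mathcal{P}(M)$ has no absolutely continuous part (it is singular with respect to $m$), has no atoms, and its topological support is an $m$-null set. In other words, for the last assertion: for $\mathbb{Q}^\beta$-almost every $\nu$, the topological support of $\nu^{\mathfrak c}$ is an $m$-null set. -/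

import Mathlib

open MeasureTheory

noncomputable section

namespace Entropic

/-- Euclidean space `ℝⁿ`. -/
abbrev E (n : ℕ) : Type := EuclideanSpace ℝ (Fin n)

variable {n : ℕ}

/-! ### Convex functions, monotone maps and conjugation -/

/-- The set `𝒦(M)` of `d²/2`-convex functions on `M`:
`φ(x) = - inf_{y ∈ M} [d(x,y)²/2 + ψ(y)]` for all `x ∈ M`, for some real function `ψ` on `M`.
Functions on `M` are represented by functions on `ℝⁿ` of which only the values on `M` matter.
`IsGLB` includes that the infimum is finite. -/
def IsD2Convex (M : Set (E n)) (φ : E n → ℝ) : Prop :=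
  ∃ ψ : E n → ℝ, ∀ x ∈ M, IsGLB ((fun y => dist x y ^ 2 / 2 + ψ y) '' M) (-φ x)

/-- The conjugate (generalized Legendre transform)
`φᶜ(x) = - inf_{y ∈ M} [d(x,y)²/2 + φ(y)]`. -/
def conjFun (M : Set (E n)) (φ : E n → ℝ) (x : E n) : ℝ :=
  -sInf ((fun y => dist x y ^ 2 / 2 + φ y) '' M)

/-- The map `x ↦ exp_x(∇φ(x)) = x + ∇φ(x)` on `M`; the gradient is that of `φ` as a function
on `M`, and is determined at every Lebesgue density point of `M` where `φ` is differentiable. -/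
def transportMap (M : Set (E n)) (φ : E n → ℝ) (x : E n) : E n :=
  x + gradientWithin φ M x

/-- `exp(∇φ)` pushes the reference measure `m` forward to `μ`, i.e. `exp(∇φ)_* m = μ`
(an equality of measures on `ℝⁿ`, `μ` being carried by `M`). -/
def PushesTo {M : Set (E n)} (m : Measure M) (φ : E n → ℝ) (μ : ProbabilityMeasure M) : Prop :=
  m.map (fun x : M => transportMap M φ x) = (μ : Measure M).map Subtype.val

/-- `ν` is a conjugate measure of `μ`: for some `φ ∈ 𝒦(M)`, `exp(∇φ)` is the Brenier map of `μ`
and `exp(∇φᶜ)` is the Brenier map of `ν`. -/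
def IsConjugate {M : Set (E n)} (m : Measure M) (μ ν : ProbabilityMeasure M) : Prop :=
  ∃ φ : E n → ℝ, IsD2Convex M φ ∧ PushesTo m φ μ ∧ PushesTo m (conjFun M φ) ν

open Classical in
/-- The conjugation map `μ ↦ μᶜ` on `𝒫(M)` with reference measure `m`. -/
def conj {M : Set (E n)} (m : Measure M) (μ : ProbabilityMeasure M) : ProbabilityMeasure M :=
  if h : ∃ ν, IsConjugate m μ ν then h.choose else μ

/-! ### The Dirichlet-Ferguson process and the entropic measure -/

/-- The point of the hyperplane `∑ xᵢ = 1` in `ℝ^(N+1)` with given first `N` coordinates. -/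
def simplexPoint {N : ℕ} (x : Fin N → ℝ) : Fin (N + 1) → ℝ :=
  Fin.snoc (α := fun _ => ℝ) x (1 - ∑ i, x i)

/-- The Dirichlet distribution on `ℝ^(N+1)` with parameters `α₀, …, α_N > 0`. -/
def dirichletMeasure {N : ℕ} (α : Fin (N + 1) → ℝ) : Measure (Fin (N + 1) → ℝ) :=
  ((volume : Measure (Fin N → ℝ)).withDensity
    ({x | ∀ i, 0 < simplexPoint x i}.indicator fun x =>
      ENNReal.ofReal (Real.Gamma (∑ i, α i) / (∏ i, Real.Gamma (α i)) *
        ∏ i, simplexPoint x i ^ (α i - 1)))).map simplexPoint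

/-- `Q` is (the law of) the Dirichlet-Ferguson process on `X` with intensity measure `β • m`:
for every finite measurable partition of `X` into sets `A i` of positive `m`-measure, the random
vector `(ν (A i))ᵢ` has the Dirichlet distribution with parameters `(β m(A i))ᵢ`. -/
structure IsDirichletFerguson {X : Type*} [MeasurableSpace X] (m : Measure X) (β : ℝ)
    (Q : Measure (ProbabilityMeasure X)) : Prop where
  isProbabilityMeasure : IsProbabilityMeasure Q
  map_eq : ∀ (N : ℕ) (A : Fin (N + 1) → Set X), (∀ i, MeasurableSet (A i)) →
    Pairwise (Function.onFun Disjoint A) → (⋃ i, A i) = Set.univ → (∀ i, 0 < m (A i)) →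
    Q.map (fun (ν : ProbabilityMeasure X) i => (ν : Measure X).real (A i)) = dirichletMeasure fun i => β * m.real (A i)

/-- The entropic measure: the push forward of `Q` under the conjugation map. -/
def entropicMeasure {M : Set (E n)} (m : Measure M) (Q : Measure (ProbabilityMeasure M)) :
    Measure (ProbabilityMeasure M) :=
  Q.map (conj m)

/-- The Poincaré inequality for `(M, m)`. It is only required for Lipschitz functions `u`, whose
gradient exists Lebesgue-almost everywhere. -/
def PoincareInequality {M : Set (E n)} (m : Measure M) : Prop :=
  ∃ c : ℝ, 0 < c ∧ ∀ u : E n → ℝ, (∃ K, LipschitzWith K u) → ∫ x : M, u x ∂m = 0 →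
    c * ∫ x : M, u x ^ 2 ∂m ≤ ∫ x : M, ‖gradient u (x : E n)‖ ^ 2 ∂m

end Entropic

end

/-! Expanding `|x - y|² / 2` turns `d²/2`-convexity on `M` into Legendre duality: the conjugate
pairs are `(∇f*)_* m` and `(∇f)_* m`, where `f = f**` is continuous on `M` and `*` is the Legendre
transform over `M`. Such an `f` exists for every target measure by minimizing the dual Kantorovich
functional, and is unique up to constants because a Lipschitz function with vanishing gradient is
constant `m`-almost everywhere. Hence conjugation is an involution, and it is continuous because the
normalized potentials form a compact set.

Let `ν = (∇f*)_* m` and `νᶜ = (∇f)_* m`. The convex hull of `{∇f* = z}` is open up to a null set,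
and by monotonicity its interior contains no `∇f(y)` with `y ≠ z`, so that it is a `νᶜ`-null set. If
`ν` is purely atomic, these interiors, taken over the atoms `z` of `ν`, cover `m`-almost all of `M`,
so the support of `νᶜ` is `m`-null. Dually, an atom of `νᶜ` yields a nonempty open `ν`-null set, so
`νᶜ` has no atoms when `ν` has full support.

For the Dirichlet–Ferguson process, `ν(A)` has a beta law. It does not charge `0`, whence `ν` has
full support. Moreover the expectation of `ν(A)` on the event `ν(A) < ε` is `O(ε m(A))`; summing
over the cells of finer and finer partitions shows that the diffuse part of `ν` has expected mass
`O(ε)`. -/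

noncomputable section

namespace Entropic

open Filter Topology BoundedContinuousFunction
open scoped NNReal ENNReal RealInnerProductSpace Pointwise

/-! ### The Legendre transform of a continuous function on a compact set -/

lemma exists_forall_norm_le {F : Type*} [SeminormedAddCommGroup F] (M : Set F) [CompactSpace M] :
    ∃ R : ℝ≥0, ∀ y : M, ‖(y : F)‖ ≤ R := by
  obtain ⟨R, hR⟩ := (isCompact_iff_compactSpace.2 ‹CompactSpace M›).isBounded.exists_norm_le
  exact ⟨R.toNNReal, fun y => (hR y y.2).trans (Real.le_coe_toNNReal R)⟩

section Legendre

variable {F : Type*} [NormedAddCommGroup F] [InnerProductSpace ℝ F] {M : Set F}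

/-- The Legendre transform `x ↦ sup_{y ∈ M} (⟪x, y⟫ - f y)`, as a function on the whole space. -/
def legendre (f : M →ᵇ ℝ) (x : F) : ℝ :=
  ⨆ y : M, (⟪x, (y : F)⟫ - f y)

variable [CompactSpace M]

lemma bddAbove_range_inner_sub (f : M →ᵇ ℝ) (x : F) :
    BddAbove (Set.range fun y : M => ⟪x, (y : F)⟫ - f y) :=
  (isCompact_range (by fun_prop)).bddAbove

lemma inner_sub_le_legendre (f : M →ᵇ ℝ) (x : F) (y : M) :
    ⟪x, (y : F)⟫ - f y ≤ legendre f x :=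
  le_ciSup (bddAbove_range_inner_sub f x) y

variable [Nonempty M]

lemma exists_legendre_eq (f : M →ᵇ ℝ) (x : F) :
    ∃ y : M, legendre f x = ⟪x, (y : F)⟫ - f y := by
  obtain ⟨y, -, hy⟩ := isCompact_univ.exists_isMaxOn Set.univ_nonempty
    (f := fun y : M => ⟪x, (y : F)⟫ - f y) (by fun_prop)
  exact ⟨y, le_antisymm (ciSup_le fun z => hy (Set.mem_univ z)) (inner_sub_le_legendre f x y)⟩

lemma legendre_le_iff {f : M →ᵇ ℝ} {x : F} {c : ℝ} :
    legendre f x ≤ c ↔ ∀ y : M, ⟪x, (y : F)⟫ - f y ≤ c :=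
  ciSup_le_iff (bddAbove_range_inner_sub f x)

lemma legendre_anti {f g : M →ᵇ ℝ} (h : ∀ y, f y ≤ g y) (x : F) :
    legendre g x ≤ legendre f x :=
  legendre_le_iff.2 fun y => by linarith [inner_sub_le_legendre f x y, h y]

lemma legendre_add_const (f : M →ᵇ ℝ) (c : ℝ) (x : F) :
    legendre (f + const M c) x = legendre f x - c := by
  refine eq_of_forall_ge_iff fun b => ?_
  simp only [sub_le_iff_le_add, legendre_le_iff, BoundedContinuousFunction.coe_add,
    Pi.add_apply, const_apply]
  exact forall_congr' fun y => by constructor <;> intro h <;> linarith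

lemma lipschitzWith_legendre {R : ℝ≥0} (hR : ∀ y : M, ‖(y : F)‖ ≤ R) (f : M →ᵇ ℝ) :
    LipschitzWith R (legendre f) := by
  refine LipschitzWith.of_le_add_mul R fun x x' => legendre_le_iff.2 fun y => ?_
  have hle : ⟪x - x', (y : F)⟫ ≤ R * dist x x' := by
    rw [dist_eq_norm, mul_comm]
    exact (real_inner_le_norm _ _).trans (by gcongr; exact hR y)
  rw [inner_sub_left] at hle
  linarith [inner_sub_le_legendre f x' y]

lemma exists_lipschitzWith_legendre (f : M →ᵇ ℝ) : ∃ K, LipschitzWith K (legendre f) :=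
  (exists_forall_norm_le M).imp fun _ hR => lipschitzWith_legendre hR f

lemma legendre_le_add_dist (f g : M →ᵇ ℝ) (x : F) :
    legendre f x ≤ legendre g x + dist f g := by
  refine legendre_le_iff.2 fun y => ?_
  have hdist := (abs_le.1 ((Real.dist_eq _ _).symm.trans_le (f.dist_coe_le_dist (g := g) y))).1
  linarith [inner_sub_le_legendre g x y]

lemma dist_legendre_le (f g : M →ᵇ ℝ) (x : F) :
    dist (legendre f x) (legendre g x) ≤ dist f g := by
  have h := legendre_le_add_dist g f x
  rw [dist_comm g f] at h
  rw [Real.dist_eq, abs_le]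
  constructor <;> linarith [legendre_le_add_dist f g x]

/-- The Legendre transform as an operator on the continuous functions on `M`. -/
def legendreOn (f : M →ᵇ ℝ) : M →ᵇ ℝ :=
  mkOfCompact ⟨fun x => legendre f x,
    (exists_lipschitzWith_legendre f).choose_spec.continuous.comp continuous_subtype_val⟩

@[simp]
lemma legendreOn_apply (f : M →ᵇ ℝ) (x : M) : legendreOn f x = legendre f x := rfl

lemma continuous_legendreOn : Continuous (legendreOn : (M →ᵇ ℝ) → (M →ᵇ ℝ)) :=
  LipschitzWith.continuous (K := 1) <| LipschitzWith.of_dist_le_mul fun f g => by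
    rw [NNReal.coe_one, one_mul, dist_le dist_nonneg]
    exact fun x => dist_legendre_le f g x

lemma legendreOn_add_const (f : M →ᵇ ℝ) (c : ℝ) :
    legendreOn (f + const M c) = legendreOn f + const M (-c) := by
  ext x
  simp [legendre_add_const, sub_eq_add_neg]

lemma legendreOn_legendreOn_le (f : M →ᵇ ℝ) (y : M) : legendreOn (legendreOn f) y ≤ f y := by
  refine legendre_le_iff.2 fun x => ?_
  rw [real_inner_comm, legendreOn_apply]
  linarith [inner_sub_le_legendre f x y]

/-- `f` is its own double Legendre transform on `M`. Up to the quadratic term `‖·‖² / 2`, these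
are the `d²/2`-convex functions on `M`. -/
def IsBiconjugate (f : M →ᵇ ℝ) : Prop :=
  legendreOn (legendreOn f) = f

lemma isBiconjugate_legendreOn (f : M →ᵇ ℝ) : IsBiconjugate (legendreOn f) := by
  ext x
  exact le_antisymm (legendreOn_legendreOn_le _ x) (legendre_anti (legendreOn_legendreOn_le f) x)

lemma IsBiconjugate.add_const {f : M →ᵇ ℝ} (hf : IsBiconjugate f) (c : ℝ) :
    IsBiconjugate (f + const M c) := by
  rw [IsBiconjugate, legendreOn_add_const, legendreOn_add_const, hf, neg_neg]

end Legendre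

/-! ### The gradient of the Legendre transform -/

section BrenierMap

variable {F : Type*} [NormedAddCommGroup F] [InnerProductSpace ℝ F] [CompleteSpace F] {M : Set F}

lemma hasGradientAt_legendre [CompactSpace M] {f : M →ᵇ ℝ} {x : F}
    (hd : DifferentiableAt ℝ (legendre f) x) {y : M} (hy : legendre f x = ⟪x, (y : F)⟫ - f y) :
    HasGradientAt (legendre f) (y : F) x := by
  have hmin : IsLocalMin (fun x' : F => legendre f x' - innerSL ℝ (y : F) x') x := by
    refine Eventually.of_forall fun x' => ?_
    simp only [innerSL_apply_apply, real_inner_comm _ (y : F), hy]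
    linarith [inner_sub_le_legendre f x' y]
  have hzero := hmin.hasFDerivAt_eq_zero (hd.hasFDerivAt.sub (innerSL ℝ (y : F)).hasFDerivAt)
  rw [hasGradientAt_iff_hasFDerivAt]
  exact sub_eq_zero.1 hzero ▸ hd.hasFDerivAt

open Classical in
/-- The map `x ↦ ∇ (legendre f) x` as a self-map of `M`. Wherever `legendre f` is differentiable
the gradient does lie in `M`; the value is a junk one at the remaining points. -/
def brenierMap (f : M →ᵇ ℝ) (x : M) : M :=
  if h : gradient (legendre f) (x : F) ∈ M then ⟨_, h⟩ else x

lemma brenierMap_eq [CompactSpace M] {f : M →ᵇ ℝ} {x : M}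
    (hd : DifferentiableAt ℝ (legendre f) (x : F))
    {y : M} (hy : legendre f x = ⟪(x : F), (y : F)⟫ - f y) : brenierMap f x = y := by
  have hgrad := (hasGradientAt_legendre hd hy).gradient
  have hmem : gradient (legendre f) (x : F) ∈ M := hgrad ▸ y.2
  rw [brenierMap, dif_pos hmem]
  exact Subtype.ext hgrad

lemma measurable_brenierMap [MeasurableSpace F] [BorelSpace F] (hM : MeasurableSet M)
    (f : M →ᵇ ℝ) : Measurable (brenierMap f) := by
  have hgrad : Measurable (gradient (legendre f)) :=
    (InnerProductSpace.toDual ℝ F).symm.continuous.measurable.comp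
      (measurable_fderiv ℝ (legendre f))
  have hgrad' : Measurable fun x : M => gradient (legendre f) (x : F) :=
    hgrad.comp measurable_subtype_coe
  classical
  exact Measurable.dite (s := {x : M | gradient (legendre f) (x : F) ∈ M})
    (f := fun x => (⟨_, x.2⟩ : M)) (g := fun x => (x : M))
    (hgrad'.comp measurable_subtype_coe).subtype_mk measurable_subtype_coe (hgrad' hM)

variable [CompactSpace M] [Nonempty M]

lemma legendre_eq_brenierMap {f : M →ᵇ ℝ} {x : M}
    (hd : DifferentiableAt ℝ (legendre f) (x : F)) :
    legendre f x = ⟪(x : F), (brenierMap f x : F)⟫ - f (brenierMap f x) := by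
  obtain ⟨y, hy⟩ := exists_legendre_eq f (x : F)
  rwa [brenierMap_eq hd hy]

lemma hasGradientAt_brenierMap {f : M →ᵇ ℝ} {x : M}
    (hd : DifferentiableAt ℝ (legendre f) (x : F)) :
    HasGradientAt (legendre f) (brenierMap f x : F) (x : F) :=
  hasGradientAt_legendre hd (legendre_eq_brenierMap hd)

lemma brenierMap_add_const {f : M →ᵇ ℝ} (c : ℝ) {x : M}
    (hd : DifferentiableAt ℝ (legendre f) (x : F)) :
    brenierMap (f + const M c) x = brenierMap f x := by
  have heq : legendre (f + const M c) = fun x => legendre f x - c :=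
    funext (legendre_add_const f c)
  refine brenierMap_eq (heq ▸ hd.sub_const c) ?_
  rw [legendre_add_const, legendre_eq_brenierMap hd]
  simp [sub_sub]

/-- A limit point `y` of the maximizers `brenierMap (u i) x` is a maximizer for `f`, and the
maximizer for `f` is unique. -/
lemma tendsto_brenierMap {ι : Type*} {l : Filter ι} {u : ι → M →ᵇ ℝ} {f : M →ᵇ ℝ}
    (hu : Tendsto u l (𝓝 f)) {x : M} (hd : DifferentiableAt ℝ (legendre f) (x : F))
    (hdu : ∀ i, DifferentiableAt ℝ (legendre (u i)) (x : F)) :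
    Tendsto (fun i => brenierMap (u i) x) l (𝓝 (brenierMap f x)) := by
  let gap : M → ℝ := fun y => legendre f x - (⟪(x : F), (y : F)⟫ - f y)
  have hgap : Continuous gap := by fun_prop
  have hlim : Tendsto (fun i => gap (brenierMap (u i) x)) l (𝓝 0) := by
    have hdist : Tendsto (fun i => 2 * dist (u i) f) l (𝓝 0) := by
      simpa using (tendsto_iff_dist_tendsto_zero.1 hu).const_mul 2
    refine squeeze_zero (fun i => sub_nonneg.2 (inner_sub_le_legendre f x _)) (fun i => ?_) hdist
    have hle := legendre_le_add_dist f (u i) (x : F)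
    have hclose := (abs_le.1 ((Real.dist_eq _ _).symm.trans_le
      ((u i).dist_coe_le_dist (g := f) (brenierMap (u i) x)))).1
    rw [dist_comm] at hle
    linarith [legendre_eq_brenierMap (hdu i)]
  refine tendsto_nhds_of_unique_mapClusterPt fun y hy => (brenierMap_eq hd ?_).symm
  have hzero : gap y = 0 :=
    eq_of_nhds_neBot ((hy.continuousAt_comp hgap.continuousAt).clusterPt.mono hlim).neBot
  exact sub_eq_zero.1 hzero

lemma legendre_add_sub_le {f g : M →ᵇ ℝ} {x : M}
    (hd : DifferentiableAt ℝ (legendre g) (x : F)) :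
    legendreOn g x + (g - f) (brenierMap g x) ≤ legendreOn f x := by
  have hle := inner_sub_le_legendre f (x : F) (brenierMap g x)
  simp only [legendreOn_apply, legendre_eq_brenierMap hd, BoundedContinuousFunction.coe_sub,
    Pi.sub_apply]
  linarith

end BrenierMap

/-! ### The dual Kantorovich problem -/

section Integral

variable {X : Type*} [TopologicalSpace X] [MeasurableSpace X] [OpensMeasurableSpace X]

lemma continuous_integral_boundedContinuousFunction (m : Measure X) [IsProbabilityMeasure m] :
    Continuous fun f : X →ᵇ ℝ => ∫ x, f x ∂m :=
  LipschitzWith.continuous (K := 1) <| LipschitzWith.of_dist_le_mul fun f g => by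
    rw [NNReal.coe_one, one_mul, dist_eq_norm, ← integral_sub (f.integrable m) (g.integrable m),
      dist_eq_norm]
    exact (f - g).norm_integral_le_norm m

end Integral

lemma ae_subtype_of_ae {X : Type*} [MeasurableSpace X] {s : Set X} {m : Measure s} {μ : Measure X}
    (hac : m.map Subtype.val ≪ μ) {p : X → Prop} (hp : ∀ᵐ x ∂μ, p x) : ∀ᵐ x : s ∂m, p x :=
  ae_of_ae_map measurable_subtype_coe.aemeasurable (hac.ae_le hp)

section DualFunctional

variable {F : Type*} [NormedAddCommGroup F] [InnerProductSpace ℝ F] [MeasurableSpace F]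
  [BorelSpace F] {M : Set F} [CompactSpace M] [Nonempty M]

/-- The dual Kantorovich functional for the cost `-⟪x, y⟫`; its minimizers are the potentials of
the optimal transport map from `m` to `ν`. -/
def dualFunctional (m ν : Measure M) (f : M →ᵇ ℝ) : ℝ :=
  ∫ x, legendreOn f x ∂m + ∫ y, f y ∂ν

/-- The normalized biconjugate functions, one candidate potential for each transport map. -/
def potentials (m : Measure M) : Set (M →ᵇ ℝ) :=
  {f | IsBiconjugate f ∧ ∫ x, f x ∂m = 0}

lemma dualFunctional_biconjugate_le (ν : Measure M) [IsProbabilityMeasure ν] (f : M →ᵇ ℝ) :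
    dualFunctional m ν (legendreOn (legendreOn f)) ≤ dualFunctional m ν f := by
  rw [dualFunctional, isBiconjugate_legendreOn f]
  exact add_le_add le_rfl
    (integral_mono (BoundedContinuousFunction.integrable _ _) (f.integrable _)
      (legendreOn_legendreOn_le f))

variable {m : Measure M} [IsProbabilityMeasure m]

lemma abs_le_of_mem_potentials {R : ℝ≥0} (hR : ∀ y : M, ‖(y : F)‖ ≤ R) {f : M →ᵇ ℝ}
    (hf : f ∈ potentials m) (y : M) : |f y| ≤ R * (R + R) := by
  have hmean : f y = ∫ x, (f y - f x) ∂m := by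
    rw [integral_sub (integrable_const _) (f.integrable m), hf.2]
    simp
  have hosc : ∀ x, ‖f y - f x‖ ≤ R * (R + R) := fun x => by
    have hLip : dist (legendre (legendreOn f) (y : F)) (legendre (legendreOn f) x) ≤ _ :=
      (lipschitzWith_legendre hR (legendreOn f)).dist_le_mul y x
    rw [← legendreOn_apply, ← legendreOn_apply, hf.1, dist_eq_norm, dist_eq_norm] at hLip
    exact hLip.trans (by gcongr; exact (norm_sub_le _ _).trans (add_le_add (hR y) (hR x)))
  rw [hmean, ← Real.norm_eq_abs]
  simpa using norm_integral_le_of_norm_le_const (μ := m) (ae_of_all _ hosc)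

variable (m) in
lemma isCompact_potentials : IsCompact (potentials m) := by
  obtain ⟨R, hR⟩ := exists_forall_norm_le M
  refine arzela_ascoli₂ (Set.Icc (-(R * (R + R)) : ℝ) (R * (R + R))) isCompact_Icc _ ?_
    (fun f y hf => abs_le.1 (abs_le_of_mem_potentials hR hf y)) ?_
  · exact (isClosed_eq (continuous_legendreOn.comp continuous_legendreOn) continuous_id).inter
      (isClosed_eq (continuous_integral_boundedContinuousFunction m) continuous_const)
  · refine (LipschitzWith.uniformEquicontinuous (fun f : potentials m => (f : M → ℝ)) R
      fun f => ?_).equicontinuous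
    rw [← f.2.1]
    exact fun x y => lipschitzWith_legendre hR _ x y

lemma IsBiconjugate.exists_add_const_mem_potentials {f : M →ᵇ ℝ} (hf : IsBiconjugate f) :
    ∃ c, f + const M c ∈ potentials m :=
  ⟨-∫ x, f x ∂m, hf.add_const _, by
    rw [BoundedContinuousFunction.integral_add_const, probReal_univ, one_smul, add_neg_cancel]⟩

lemma continuous_dualFunctional (m ν : Measure M) [IsProbabilityMeasure m]
    [IsProbabilityMeasure ν] : Continuous (dualFunctional m ν) :=
  ((continuous_integral_boundedContinuousFunction m).comp continuous_legendreOn).add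
    (continuous_integral_boundedContinuousFunction ν)

lemma dualFunctional_add_const (ν : Measure M) [IsProbabilityMeasure ν] (f : M →ᵇ ℝ) (c : ℝ) :
    dualFunctional m ν (f + const M c) = dualFunctional m ν f := by
  rw [dualFunctional, legendreOn_add_const, BoundedContinuousFunction.integral_add_const,
    BoundedContinuousFunction.integral_add_const, probReal_univ, probReal_univ, one_smul, one_smul,
    dualFunctional]
  ring

lemma exists_mem_potentials_dualFunctional_le (ν : Measure M) [IsProbabilityMeasure ν]
    (g : M →ᵇ ℝ) : ∃ f ∈ potentials m, dualFunctional m ν f ≤ dualFunctional m ν g := by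
  obtain ⟨c, hc⟩ :=
    (isBiconjugate_legendreOn (legendreOn g)).exists_add_const_mem_potentials (m := m)
  exact ⟨_, hc, (dualFunctional_add_const ν _ c).trans_le (dualFunctional_biconjugate_le ν g)⟩

variable (m) in
lemma exists_forall_dualFunctional_le (ν : Measure M) [IsProbabilityMeasure ν] :
    ∃ f ∈ potentials m, ∀ g, dualFunctional m ν f ≤ dualFunctional m ν g := by
  have hne : (potentials m).Nonempty :=
    (exists_mem_potentials_dualFunctional_le ν 0).imp fun _ h => h.1
  obtain ⟨f, hf, hmin⟩ := (isCompact_potentials m).exists_isMinOn hne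
    (continuous_dualFunctional m ν).continuousOn
  refine ⟨f, hf, fun g => ?_⟩
  obtain ⟨g', hg', hle⟩ := exists_mem_potentials_dualFunctional_le (m := m) ν g
  exact (hmin hg').trans hle

end DualFunctional

/-! ### Brenier potentials -/

section BrenierMeasure

variable {F : Type*} [NormedAddCommGroup F] [InnerProductSpace ℝ F] [FiniteDimensional ℝ F]
  [MeasurableSpace F] [BorelSpace F] {M : Set F} [CompactSpace M]

lemma measurable_brenierMap_of_compactSpace (f : M →ᵇ ℝ) : Measurable (brenierMap f) :=
  measurable_brenierMap (isCompact_iff_compactSpace.2 ‹CompactSpace M›).measurableSet f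

/-- The push forward of `m` under `∇ (legendre f)`. -/
def brenierMeasure (m : Measure M) [IsProbabilityMeasure m] (f : M →ᵇ ℝ) : ProbabilityMeasure M :=
  ⟨m.map (brenierMap f),
    Measure.isProbabilityMeasure_map (measurable_brenierMap_of_compactSpace f).aemeasurable⟩

lemma integral_brenierMeasure (m : Measure M) [IsProbabilityMeasure m] (f h : M →ᵇ ℝ) :
    ∫ y, h y ∂(brenierMeasure m f : Measure M) = ∫ x, h (brenierMap f x) ∂m :=
  integral_map (measurable_brenierMap_of_compactSpace f).aemeasurable
    h.continuous.aestronglyMeasurable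

lemma integrable_comp_brenierMap {m : Measure M} [IsProbabilityMeasure m] (f h : M →ᵇ ℝ) :
    Integrable (fun x => h (brenierMap f x)) m :=
  (h.integrable (brenierMeasure m f : Measure M)).comp_measurable
    (measurable_brenierMap_of_compactSpace f)

variable [Nonempty M]

lemma ae_differentiableAt_legendre {m : Measure M} (hac : m.map Subtype.val ≪ volume)
    (f : M →ᵇ ℝ) : ∀ᵐ x : M ∂m, DifferentiableAt ℝ (legendre f) (x : F) :=
  (exists_lipschitzWith_legendre f).elim fun _ hK => ae_subtype_of_ae hac hK.ae_differentiableAt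

variable {m : Measure M} [IsProbabilityMeasure m]

lemma tendsto_integral_comp_brenierMap (hac : m.map Subtype.val ≪ volume) {u : ℕ → M →ᵇ ℝ}
    {f : M →ᵇ ℝ} (hu : Tendsto u atTop (𝓝 f)) (h : M →ᵇ ℝ) :
    Tendsto (fun k => ∫ x, h (brenierMap (u k) x) ∂m) atTop (𝓝 (∫ x, h (brenierMap f x) ∂m)) := by
  refine tendsto_integral_of_dominated_convergence (fun _ => ‖h‖)
    (fun k => (integrable_comp_brenierMap (u k) h).aestronglyMeasurable)
    (integrable_const _) (fun k => ae_of_all _ fun x => h.norm_coe_le_norm _) ?_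
  filter_upwards [ae_differentiableAt_legendre hac f,
    ae_all_iff.2 fun k => ae_differentiableAt_legendre hac (u k)] with x hx hxu
  exact (h.continuous.tendsto _).comp (tendsto_brenierMap hu hx hxu)

lemma continuous_brenierMeasure (hac : m.map Subtype.val ≪ volume) :
    Continuous (brenierMeasure m) := by
  refine continuous_iff_seqContinuous.2 fun u f hu => ?_
  refine ProbabilityMeasure.tendsto_iff_forall_integral_tendsto.2 fun h => ?_
  simp only [Function.comp_apply, integral_brenierMeasure]
  exact tendsto_integral_comp_brenierMap hac hu h

lemma brenierMeasure_add_const (hac : m.map Subtype.val ≪ volume) (f : M →ᵇ ℝ) (c : ℝ) :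
    brenierMeasure m (f + const M c) = brenierMeasure m f :=
  Subtype.ext <| Measure.map_congr <|
    (ae_differentiableAt_legendre hac f).mono fun _ hx => brenierMap_add_const c hx

/-- Minus `brenierMeasure m g` is a subgradient of `f ↦ ∫ legendre f ∂m` at `g`. -/
lemma integral_legendreOn_add_integral_brenierMeasure_le (hac : m.map Subtype.val ≪ volume)
    (f g : M →ᵇ ℝ) :
    ∫ x, legendreOn g x ∂m + ∫ y, (g - f) y ∂(brenierMeasure m g : Measure M)
      ≤ ∫ x, legendreOn f x ∂m := by
  have hint := integrable_comp_brenierMap (m := m) g (g - f)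
  rw [integral_brenierMeasure, ← integral_add ((legendreOn g).integrable m) hint]
  exact integral_mono_ae (((legendreOn g).integrable m).add hint) ((legendreOn f).integrable m)
    ((ae_differentiableAt_legendre hac g).mono fun _ hx => legendre_add_sub_le hx)

lemma integral_comp_brenierMap_le (hac : m.map Subtype.val ≪ volume) (ν : Measure M)
    [IsProbabilityMeasure ν] {f : M →ᵇ ℝ}
    (hf : ∀ g, dualFunctional m ν f ≤ dualFunctional m ν g) (h : M →ᵇ ℝ) :
    ∫ x, h (brenierMap f x) ∂m ≤ ∫ y, h y ∂ν := by
  have hpos : ∀ t : ℝ, 0 < t → ∫ x, h (brenierMap (f + t • h) x) ∂m ≤ ∫ y, h y ∂ν := by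
    intro t ht
    have hsub := integral_legendreOn_add_integral_brenierMeasure_le hac f (f + t • h)
    have hmin := hf (f + t • h)
    simp only [dualFunctional, add_sub_cancel_left, BoundedContinuousFunction.coe_add,
      Pi.add_apply, BoundedContinuousFunction.coe_smul, smul_eq_mul, integral_const_mul,
      integral_add (f.integrable ν) ((h.integrable ν).const_mul t), integral_brenierMeasure]
      at hsub hmin
    exact le_of_mul_le_mul_left (by linarith) ht
  have hlim : Tendsto (fun k : ℕ => f + (1 / ((k : ℝ) + 1)) • h) atTop (𝓝 f) := by
    simpa using tendsto_const_nhds.add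
      ((tendsto_one_div_add_atTop_nhds_zero_nat (𝕜 := ℝ)).smul_const h)
  exact le_of_tendsto' (tendsto_integral_comp_brenierMap hac hlim h) fun k =>
    hpos _ Nat.one_div_pos_of_nat

theorem exists_brenierMeasure_eq (hac : m.map Subtype.val ≪ volume) (ν : ProbabilityMeasure M) :
    ∃ f ∈ potentials m, brenierMeasure m f = ν := by
  obtain ⟨f, hf, hmin⟩ := exists_forall_dualFunctional_le m (ν : Measure M)
  refine ⟨f, hf, Subtype.ext ?_⟩
  refine ext_of_forall_integral_eq_of_IsFiniteMeasure (μ := m.map (brenierMap f))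
    (ν := (ν : Measure M)) fun h => ?_
  have hneg := integral_comp_brenierMap_le hac _ hmin (-h)
  simp only [BoundedContinuousFunction.coe_neg, Pi.neg_apply, integral_neg, neg_le_neg_iff] at hneg
  exact (integral_brenierMeasure m f h).trans
    (le_antisymm (integral_comp_brenierMap_le hac _ hmin h) hneg)

/-- If the subgradients at `f` and at `g` agree, the two subgradient inequalities between `f` and
`g` are equalities. -/
lemma brenierMap_ae_eq (hac : m.map Subtype.val ≪ volume) {f g : M →ᵇ ℝ}
    (hfg : brenierMeasure m f = brenierMeasure m g) : brenierMap f =ᵐ[m] brenierMap g := by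
  have hint := integrable_comp_brenierMap (m := m) g (g - f)
  have heq : ∫ x, (legendreOn g x + (g - f) (brenierMap g x)) ∂m = ∫ x, legendreOn f x ∂m := by
    have hle := integral_legendreOn_add_integral_brenierMeasure_le hac f g
    have hge := integral_legendreOn_add_integral_brenierMeasure_le hac g f
    rw [hfg, ← neg_sub g f] at hge
    simp only [BoundedContinuousFunction.coe_neg, Pi.neg_apply, integral_neg] at hge
    rw [integral_add ((legendreOn g).integrable m) hint, ← integral_brenierMeasure]
    linarith
  have hae := (integral_eq_iff_of_ae_le (((legendreOn g).integrable m).add hint)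
    ((legendreOn f).integrable m)
    ((ae_differentiableAt_legendre hac g).mono fun _ hx => legendre_add_sub_le hx)).1 heq
  filter_upwards [hae, ae_differentiableAt_legendre hac f, ae_differentiableAt_legendre hac g]
    with x hx hf hg
  refine brenierMap_eq hf ?_
  simp only [Pi.add_apply, legendreOn_apply, legendre_eq_brenierMap hg,
    BoundedContinuousFunction.coe_sub, Pi.sub_apply] at hx
  linarith

end BrenierMeasure

/-! ### Uniqueness of the Brenier potential -/

/-- Every Lipschitz function whose gradient vanishes `m`-almost everywhere is constant
`m`-almost everywhere: the qualitative form of the Poincaré inequality, which makes Brenier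
potentials unique up to constants. -/
def IsIrreducible {F : Type*} [NormedAddCommGroup F] [InnerProductSpace ℝ F] [CompleteSpace F]
    [MeasurableSpace F] {M : Set F} (m : Measure M) : Prop :=
  ∀ u : F → ℝ, (∃ K, LipschitzWith K u) → (∀ᵐ x : M ∂m, gradient u (x : F) = 0) →
    ∃ c, ∀ᵐ x : M ∂m, u x = c

lemma PoincareInequality.isIrreducible {n : ℕ} {M : Set (E n)} [CompactSpace M] {m : Measure M}
    [IsProbabilityMeasure m] (hm : PoincareInequality m) : IsIrreducible m := by
  obtain ⟨c, hc, hm⟩ := hm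
  rintro u ⟨K, hu⟩ hgrad
  have hint : ∀ v : E n → ℝ, Continuous v → Integrable (fun x : M => v x) m := fun v hv =>
    (mkOfCompact ⟨fun x : M => v x, hv.comp continuous_subtype_val⟩).integrable m
  refine ⟨∫ x : M, u x ∂m, ?_⟩
  let v : E n → ℝ := fun x => u x - ∫ x : M, u x ∂m
  have hv : LipschitzWith (K + 0) v := hu.sub (LipschitzWith.const _)
  have hmean : ∫ x : M, v x ∂m = 0 := by
    simp [v, integral_sub (hint u hu.continuous) (integrable_const _)]
  have henergy : ∫ x : M, ‖gradient v (x : E n)‖ ^ 2 ∂m = 0 := by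
    refine integral_eq_zero_of_ae (hgrad.mono fun x hx => ?_)
    simp only [gradient, v, fderiv_sub_const] at hx ⊢
    simp [hx]
  have hvar : ∫ x : M, v x ^ 2 ∂m = 0 :=
    le_antisymm (nonpos_of_mul_nonpos_right ((hm v ⟨_, hv⟩ hmean).trans_eq henergy) hc)
      (integral_nonneg fun x => sq_nonneg _)
  rw [integral_eq_zero_iff_of_nonneg (fun x => sq_nonneg _) (hint _ (hv.continuous.pow 2))] at hvar
  exact hvar.mono fun x hx => sub_eq_zero.1 (pow_eq_zero_iff two_ne_zero |>.1 hx)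

section Uniqueness

variable {F : Type*} [NormedAddCommGroup F] [InnerProductSpace ℝ F] [FiniteDimensional ℝ F]
  [MeasurableSpace F] [BorelSpace F] {M : Set F} [CompactSpace M] [Nonempty M] {m : Measure M}

lemma IsIrreducible.exists_legendreOn_eq_add_const (hm : IsIrreducible m) [m.IsOpenPosMeasure]
    (hac : m.map Subtype.val ≪ volume) {f g : M →ᵇ ℝ} (hfg : brenierMap f =ᵐ[m] brenierMap g) :
    ∃ c : ℝ, legendreOn f = legendreOn g + const M c := by
  obtain ⟨K, hK⟩ := exists_lipschitzWith_legendre f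
  obtain ⟨L, hL⟩ := exists_lipschitzWith_legendre g
  have hgrad : ∀ᵐ x : M ∂m, gradient (fun x => legendre f x - legendre g x) (x : F) = 0 := by
    filter_upwards [hfg, ae_differentiableAt_legendre hac f, ae_differentiableAt_legendre hac g]
      with x hx hf hg
    have hsub := (hasGradientAt_brenierMap hf).hasFDerivAt.sub
      (hasGradientAt_brenierMap hg).hasFDerivAt
    rw [hx, sub_self] at hsub
    simp [gradient, HasFDerivAt.fderiv (f := fun x => legendre f x - legendre g x) hsub]
  obtain ⟨c, hc⟩ := hm _ ⟨_, hK.sub hL⟩ hgrad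
  have heq : (fun x => legendreOn f x - legendreOn g x) = fun _ => c :=
    Measure.eq_of_ae_eq hc ((legendreOn f).continuous.sub (legendreOn g).continuous)
      continuous_const
  refine ⟨c, ext fun x => ?_⟩
  simpa [sub_eq_iff_eq_add'] using congrFun heq x

theorem IsIrreducible.exists_eq_add_const [IsProbabilityMeasure m] [m.IsOpenPosMeasure]
    (hm : IsIrreducible m) (hac : m.map Subtype.val ≪ volume) {f g : M →ᵇ ℝ}
    (hf : IsBiconjugate f) (hg : IsBiconjugate g) (hfg : brenierMeasure m f = brenierMeasure m g) :
    ∃ c : ℝ, f = g + const M c := by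
  obtain ⟨c, hc⟩ := hm.exists_legendreOn_eq_add_const hac (brenierMap_ae_eq hac hfg)
  exact ⟨-c, by rw [← hf, hc, legendreOn_add_const, hg]⟩

end Uniqueness

/-! ### Unique differentiability at density points -/

section DensityPoint

variable {F : Type*} [NormedAddCommGroup F] [NormedSpace ℝ F] [FiniteDimensional ℝ F]
  [MeasurableSpace F] [BorelSpace F]

lemma tangentConeAt_eq_univ_of_density_one (μ : Measure F) [μ.IsAddHaarMeasure] {s : Set F} {x : F}
    (h : Tendsto (fun r => μ (s ∩ Metric.closedBall x r) / μ (Metric.closedBall x r))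
      (𝓝[>] 0) (𝓝 1)) : tangentConeAt ℝ s x = Set.univ := by
  rw [tangentConeAt_def]
  refine Set.eq_univ_of_forall fun z => clusterPt_iff_nonempty.2 fun U hU V hV => ?_
  obtain ⟨T, hT, W, hW, hTW⟩ := Filter.mem_smul.1 hV
  obtain ⟨N, hN, hNW⟩ := mem_nhdsWithin_iff_exists_mem_nhds_inter.1 hW
  obtain ⟨ε, hε, hεU⟩ := Metric.nhds_basis_closedBall.mem_iff.1 hU
  have hmeet : ∀ᶠ r in 𝓝[>] (0 : ℝ), (s ∩ ({x} + r • Metric.closedBall z ε)).Nonempty :=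
    Measure.eventually_nonempty_inter_smul_of_density_one μ s x h _ measurableSet_closedBall
      (Metric.measure_closedBall_pos μ z hε).ne'
  have hsmall : ∀ᶠ r in 𝓝[>] (0 : ℝ), {(0 : F)} + r • Metric.closedBall z ε ⊆ N :=
    nhdsWithin_le_nhds (eventually_singleton_add_smul_subset Metric.isBounded_closedBall hN)
  obtain ⟨r, ⟨_, hs, hr⟩, hrN, hr0⟩ := (hmeet.and (hsmall.and self_mem_nhdsWithin)).exists
  rw [Set.singleton_add] at hr hrN
  obtain ⟨_, ⟨a, ha, rfl⟩, rfl⟩ := hr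
  have hW : r • a ∈ W := hNW ⟨hrN ⟨_, ⟨a, ha, rfl⟩, zero_add _⟩, hs⟩
  exact ⟨a, hεU ha, hTW ⟨r⁻¹, mem_top_iff_forall.1 hT _, _, hW, inv_smul_smul₀ (ne_of_gt hr0) a⟩⟩

lemma ae_uniqueDiffWithinAt (μ : Measure F) [μ.IsAddHaarMeasure] {s : Set F}
    (hs : MeasurableSet s) : ∀ᵐ x ∂μ, x ∈ s → UniqueDiffWithinAt ℝ s x := by
  rw [← ae_restrict_iff' hs]
  filter_upwards [Besicovitch.ae_tendsto_measure_inter_div μ s, ae_restrict_mem hs] with x hx hxs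
  refine ⟨?_, subset_closure hxs⟩
  rw [tangentConeAt_eq_univ_of_density_one μ hx, Submodule.span_univ]
  exact dense_univ

end DensityPoint

/-! ### Translation between `d²/2`-convexity and Legendre duality -/

section SupAffine

variable {F : Type*} [NormedAddCommGroup F] [InnerProductSpace ℝ F] {M : Set F} [CompactSpace M]

lemma continuous_of_isLUB_range_inner_sub {ψ g : M → ℝ}
    (hg : ∀ x : M, IsLUB (Set.range fun y : M => ⟪(x : F), (y : F)⟫ - ψ y) (g x)) :
    Continuous g := by
  obtain ⟨R, hR⟩ := exists_forall_norm_le M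
  refine (LipschitzWith.of_le_add_mul R fun x x' => (hg x).2 ?_).continuous
  rintro - ⟨y, rfl⟩
  have hdist : ⟪(x : F) - x', (y : F)⟫ ≤ R * dist x x' := by
    rw [Subtype.dist_eq, dist_eq_norm, mul_comm]
    exact (real_inner_le_norm _ _).trans (by gcongr; exact hR y)
  rw [inner_sub_left] at hdist
  linarith [(hg x').1 ⟨y, rfl⟩]

lemma isBiconjugate_of_isLUB [Nonempty M] {ψ : M → ℝ} {g : M →ᵇ ℝ}
    (hg : ∀ x : M, IsLUB (Set.range fun y : M => ⟪(x : F), (y : F)⟫ - ψ y) (g x)) :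
    IsBiconjugate g := by
  ext x
  refine le_antisymm (legendreOn_legendreOn_le g x) ((hg x).2 ?_)
  rintro - ⟨y, rfl⟩
  have hψ : legendre g (y : F) ≤ ψ y := legendre_le_iff.2 fun z => by
    rw [real_inner_comm]
    linarith [(hg z).1 ⟨y, rfl⟩]
  exact (sub_le_sub_left hψ _).trans (inner_sub_le_legendre (legendreOn g) (x : F) y)

end SupAffine

section D2Convex

variable {n : ℕ} {M : Set (E n)}

lemma half_dist_sq (x y : E n) :
    dist x y ^ 2 / 2 = ‖x‖ ^ 2 / 2 - ⟪x, y⟫ + ‖y‖ ^ 2 / 2 := by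
  rw [dist_eq_norm, norm_sub_sq_real]
  ring

lemma isLUB_range_inner_sub {φ ψ : E n → ℝ} {x : E n}
    (hφ : IsGLB ((fun y => dist x y ^ 2 / 2 + ψ y) '' M) (-φ x)) :
    IsLUB (Set.range fun y : M => ⟪x, (y : E n)⟫ - (ψ y + ‖(y : E n)‖ ^ 2 / 2))
      (φ x + ‖x‖ ^ 2 / 2) := by
  constructor
  · rintro - ⟨y, rfl⟩
    linarith [hφ.1 ⟨y, y.2, rfl⟩, half_dist_sq x y]
  · intro c hc
    have hle : ‖x‖ ^ 2 / 2 - c ≤ -φ x := by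
      refine hφ.2 ?_
      rintro - ⟨y, hy, rfl⟩
      linarith [hc ⟨⟨y, hy⟩, rfl⟩, half_dist_sq x y]
    linarith

variable [CompactSpace M] [Nonempty M]

lemma isLeast_half_dist_sq_add {φ : E n → ℝ} {f : M →ᵇ ℝ}
    (hφ : ∀ y : M, φ y = f y - ‖(y : E n)‖ ^ 2 / 2) (x : E n) :
    IsLeast ((fun y => dist x y ^ 2 / 2 + φ y) '' M) (‖x‖ ^ 2 / 2 - legendre f x) := by
  have hcost (y : M) : dist x y ^ 2 / 2 + φ y = ‖x‖ ^ 2 / 2 - (⟪x, (y : E n)⟫ - f y) := by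
    rw [half_dist_sq, hφ]
    ring
  constructor
  · obtain ⟨y, hy⟩ := exists_legendre_eq f x
    exact ⟨y, y.2, (hcost y).trans (by rw [hy])⟩
  · rintro - ⟨y, hy, rfl⟩
    linarith [hcost ⟨y, hy⟩, inner_sub_le_legendre f x ⟨y, hy⟩]

lemma conjFun_eq {φ : E n → ℝ} {f : M →ᵇ ℝ}
    (hφ : ∀ y : M, φ y = f y - ‖(y : E n)‖ ^ 2 / 2) (x : E n) :
    conjFun M φ x = legendre f x - ‖x‖ ^ 2 / 2 := by
  rw [conjFun, (isLeast_half_dist_sq_add hφ x).csInf_eq, neg_sub]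

lemma isD2Convex_legendre (f : M →ᵇ ℝ) :
    IsD2Convex M fun x => legendre f x - ‖x‖ ^ 2 / 2 := by
  classical
  refine ⟨fun y => if h : y ∈ M then f ⟨y, h⟩ - ‖y‖ ^ 2 / 2 else 0, fun x _ => ?_⟩
  rw [neg_sub]
  exact (isLeast_half_dist_sq_add (f := f) (fun y => by simp) x).isGLB

lemma IsD2Convex.exists_legendre {φ : E n → ℝ} (hφ : IsD2Convex M φ) :
    ∃ f : M →ᵇ ℝ, IsBiconjugate f ∧ ∀ x : M, φ x = legendre f x - ‖(x : E n)‖ ^ 2 / 2 := by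
  obtain ⟨ψ, hψ⟩ := hφ
  have hLUB (x : M) := isLUB_range_inner_sub (hψ x x.2)
  let g : M →ᵇ ℝ := mkOfCompact ⟨fun x : M => φ x + ‖(x : E n)‖ ^ 2 / 2,
    continuous_of_isLUB_range_inner_sub hLUB⟩
  have hg : IsBiconjugate g := isBiconjugate_of_isLUB hLUB
  refine ⟨legendreOn g, isBiconjugate_legendreOn g, fun x => ?_⟩
  have hgx : legendre (legendreOn g) (x : E n) = φ x + ‖(x : E n)‖ ^ 2 / 2 :=
    congrArg (fun u : M →ᵇ ℝ => u x) hg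
  rw [hgx, add_sub_cancel_right]

end D2Convex

lemma hasGradientAt_half_norm_sq {F : Type*} [NormedAddCommGroup F] [InnerProductSpace ℝ F]
    [CompleteSpace F] (x : F) : HasGradientAt (fun y => ‖y‖ ^ 2 / 2) x x := by
  rw [hasGradientAt_iff_hasFDerivAt]
  simp only [div_eq_inv_mul]
  convert! (hasStrictFDerivAt_norm_sq x).hasFDerivAt.const_mul (2⁻¹ : ℝ) using 1
  ext y
  simp

/-! ### The conjugation map -/

section Conjugation

variable {n : ℕ} {M : Set (E n)} [CompactSpace M] [Nonempty M] {m : Measure M}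

lemma ae_transportMap_eq (hac : m.map Subtype.val ≪ volume) {φ : E n → ℝ} {f : M →ᵇ ℝ}
    (hφ : ∀ x : M, φ x = legendre f x - ‖(x : E n)‖ ^ 2 / 2) :
    (fun x : M => transportMap M φ x) =ᵐ[m] fun x => (brenierMap f x : E n) := by
  have hM : MeasurableSet M := (isCompact_iff_compactSpace.2 ‹_›).measurableSet
  filter_upwards [ae_differentiableAt_legendre hac f,
    ae_subtype_of_ae hac (ae_uniqueDiffWithinAt volume hM)] with x hd hu
  have hfderiv := ((hasGradientAt_brenierMap hd).hasFDerivAt.sub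
    (hasGradientAt_half_norm_sq (x : E n)).hasFDerivAt).hasFDerivWithinAt.congr
    (f₁ := φ) (s := M) (fun y hy => hφ ⟨y, hy⟩) (hφ x)
  rw [transportMap, gradientWithin, hfderiv.fderivWithin (hu x.2), ← map_sub,
    LinearIsometryEquiv.symm_apply_apply, add_sub_cancel]

variable [IsProbabilityMeasure m]

lemma pushesTo_iff (hac : m.map Subtype.val ≪ volume) {φ : E n → ℝ} {f : M →ᵇ ℝ}
    (hφ : ∀ x : M, φ x = legendre f x - ‖(x : E n)‖ ^ 2 / 2) (μ : ProbabilityMeasure M) :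
    PushesTo m φ μ ↔ brenierMeasure m f = μ := by
  have hM : MeasurableSet M := (isCompact_iff_compactSpace.2 ‹_›).measurableSet
  have hmap : m.map (fun x : M => transportMap M φ x)
      = (brenierMeasure m f : Measure M).map Subtype.val :=
    (Measure.map_congr (ae_transportMap_eq hac hφ)).trans
      (Measure.map_map measurable_subtype_coe (measurable_brenierMap hM f)).symm
  rw [PushesTo, hmap]
  exact ⟨fun h => Subtype.ext ((MeasurableEmbedding.subtype_coe hM).map_injective h),
    fun h => h ▸ rfl⟩

lemma isConjugate_iff (hac : m.map Subtype.val ≪ volume) {μ ν : ProbabilityMeasure M} :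
    IsConjugate m μ ν ↔ ∃ f : M →ᵇ ℝ, IsBiconjugate f ∧
      brenierMeasure m f = μ ∧ brenierMeasure m (legendreOn f) = ν := by
  have hconj {φ : E n → ℝ} {f : M →ᵇ ℝ} (h : ∀ x : M, φ x = legendre f x - ‖(x : E n)‖ ^ 2 / 2)
      (x : M) : conjFun M φ x = legendre (legendreOn f) x - ‖(x : E n)‖ ^ 2 / 2 :=
    conjFun_eq (f := legendreOn f) h x
  constructor
  · rintro ⟨φ, hφ, hμ, hν⟩
    obtain ⟨f, hf, hφf⟩ := hφ.exists_legendre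
    exact ⟨f, hf, (pushesTo_iff hac hφf μ).1 hμ, (pushesTo_iff hac (hconj hφf) ν).1 hν⟩
  · rintro ⟨f, -, hμ, hν⟩
    exact ⟨_, isD2Convex_legendre f, (pushesTo_iff hac (fun _ => rfl) μ).2 hμ,
      (pushesTo_iff hac (hconj fun _ => rfl) ν).2 hν⟩

lemma IsConjugate.symm (hac : m.map Subtype.val ≪ volume) {μ ν : ProbabilityMeasure M}
    (h : IsConjugate m μ ν) : IsConjugate m ν μ := by
  obtain ⟨f, hf, hμ, hν⟩ := (isConjugate_iff hac).1 h
  exact (isConjugate_iff hac).2 ⟨legendreOn f, isBiconjugate_legendreOn f, hν, by rwa [hf]⟩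

theorem exists_isConjugate (hac : m.map Subtype.val ≪ volume) (μ : ProbabilityMeasure M) :
    ∃ ν, IsConjugate m μ ν := by
  obtain ⟨f, hf, hμ⟩ := exists_brenierMeasure_eq hac μ
  exact ⟨_, (isConjugate_iff hac).2 ⟨f, hf.1, hμ, rfl⟩⟩

lemma isConjugate_conj (hac : m.map Subtype.val ≪ volume) (μ : ProbabilityMeasure M) :
    IsConjugate m μ (conj m μ) := by
  have h := exists_isConjugate hac μ
  rw [conj, dif_pos h]
  exact h.choose_spec

variable [m.IsOpenPosMeasure]

lemma IsConjugate.unique (hac : m.map Subtype.val ≪ volume) (hm : IsIrreducible m)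
    {μ ν ν' : ProbabilityMeasure M} (h : IsConjugate m μ ν) (h' : IsConjugate m μ ν') :
    ν = ν' := by
  obtain ⟨f, hf, hfμ, rfl⟩ := (isConjugate_iff hac).1 h
  obtain ⟨g, hg, hgμ, rfl⟩ := (isConjugate_iff hac).1 h'
  obtain ⟨c, rfl⟩ := hm.exists_eq_add_const hac hf hg (hfμ.trans hgμ.symm)
  rw [legendreOn_add_const, brenierMeasure_add_const hac]

lemma conj_involutive (hac : m.map Subtype.val ≪ volume) (hm : IsIrreducible m) :
    Function.Involutive (conj m) := fun μ =>
  (isConjugate_conj hac (conj m μ)).unique hac hm ((isConjugate_conj hac μ).symm hac)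

lemma conj_brenierMeasure (hac : m.map Subtype.val ≪ volume) (hm : IsIrreducible m) {f : M →ᵇ ℝ}
    (hf : IsBiconjugate f) : conj m (brenierMeasure m f) = brenierMeasure m (legendreOn f) :=
  (isConjugate_conj hac _).unique hac hm ((isConjugate_iff hac).2 ⟨f, hf, rfl, rfl⟩)

/-- `conj m` is continuous because `brenierMeasure m` is a quotient map from the compact set of
normalized potentials. -/
theorem continuous_conj (hac : m.map Subtype.val ≪ volume) (hm : IsIrreducible m) :
    Continuous (conj m) := by
  have : CompactSpace (potentials m) := isCompact_iff_compactSpace.1 (isCompact_potentials m)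
  have hcont : Continuous fun f : potentials m => brenierMeasure m f.1 :=
    (continuous_brenierMeasure hac).comp continuous_subtype_val
  have hquot : IsQuotientMap fun f : potentials m => brenierMeasure m f.1 := by
    refine hcont.isClosedMap.isQuotientMap hcont fun ν => ?_
    obtain ⟨f, hf, h⟩ := exists_brenierMeasure_eq hac ν
    exact ⟨⟨f, hf⟩, h⟩
  rw [hquot.continuous_iff]
  refine ((continuous_brenierMeasure hac).comp
    (continuous_legendreOn.comp continuous_subtype_val)).congr fun f => ?_
  exact (conj_brenierMeasure hac hm f.2.1).symm

end Conjugation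

/-! ### Borel sets of the space of probability measures -/

section BorelProbabilityMeasure

variable {X : Type*} [TopologicalSpace X] [MeasurableSpace X]

lemma isInducing_testAgainstNN [OpensMeasurableSpace X] :
    IsInducing fun (μ : ProbabilityMeasure X) (f : X →ᵇ ℝ≥0) =>
      μ.toFiniteMeasure.testAgainstNN f := by
  have hdual : IsInducing fun (φ : WeakDual ℝ≥0 (X →ᵇ ℝ≥0)) (f : X →ᵇ ℝ≥0) => φ f := ⟨rfl⟩
  have hfinite : IsInducing (FiniteMeasure.toWeakDualBCNN (Ω := X)) := ⟨rfl⟩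
  exact (hdual.comp hfinite).comp (ProbabilityMeasure.toFiniteMeasure_isEmbedding X).isInducing

variable [BorelSpace X]

lemma borel_probabilityMeasure_le [SecondCountableTopology (ProbabilityMeasure X)] :
    borel (ProbabilityMeasure X) ≤ (inferInstance : MeasurableSpace (ProbabilityMeasure X)) := by
  have htop : (inferInstance : TopologicalSpace (ProbabilityMeasure X))
      = .generateFrom (⋃ f : X →ᵇ ℝ≥0, {s | IsOpen[.induced
        (fun μ : ProbabilityMeasure X => μ.toFiniteMeasure.testAgainstNN f) inferInstance] s}) := by
    refine isInducing_testAgainstNN.eq_induced.trans (Eq.trans ?_ (generateFrom_iUnion_isOpen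
      fun f : X →ᵇ ℝ≥0 => .induced (fun μ : ProbabilityMeasure X =>
        μ.toFiniteMeasure.testAgainstNN f) inferInstance).symm)
    simp only [Pi.topologicalSpace, induced_iInf, induced_compose]
    rfl
  rw [borel_eq_generateFrom_of_subbasis htop]
  refine MeasurableSpace.generateFrom_le fun s hs => ?_
  obtain ⟨f, hf⟩ := Set.mem_iUnion.1 hs
  obtain ⟨t, ht, rfl⟩ := isOpen_induced_iff.1 hf
  have hmeas : Measurable fun μ : ProbabilityMeasure X => μ.toFiniteMeasure.testAgainstNN f :=
    ENNReal.measurable_toNNReal.comp ((Measure.measurable_lintegral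
      (measurable_coe_nnreal_ennreal.comp f.continuous.measurable)).comp measurable_subtype_coe)
  exact hmeas ht.measurableSet

lemma probabilityMeasure_le_borel [HasOuterApproxClosed X] :
    (inferInstance : MeasurableSpace (ProbabilityMeasure X)) ≤ borel (ProbabilityMeasure X) := by
  let _ : MeasurableSpace (ProbabilityMeasure X) := borel _
  have : BorelSpace (ProbabilityMeasure X) := ⟨rfl⟩
  have hcoe : Measurable fun μ : ProbabilityMeasure X => (μ : Measure X) := by
    refine Measurable.measure_of_isPiSystem_of_isProbabilityMeasure
      (BorelSpace.measurable_eq.trans borel_eq_generateFrom_isClosed) isPiSystem_isClosed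
      fun C hC => ?_
    refine measurable_of_tendsto_metrizable (fun k => ?_)
      (tendsto_pi_nhds.2 fun μ =>
        HasOuterApproxClosed.tendsto_lintegral_apprSeq hC μ)
    exact (ProbabilityMeasure.continuous_lintegral_boundedContinuousFunction _).measurable
  exact hcoe.comap_le

theorem borelSpace_probabilityMeasure [HasOuterApproxClosed X]
    [SecondCountableTopology (ProbabilityMeasure X)] : BorelSpace (ProbabilityMeasure X) :=
  ⟨le_antisymm probabilityMeasure_le_borel borel_probabilityMeasure_le⟩

end BorelProbabilityMeasure

/-! ### Cells of a transport map and the support of the conjugate measure -/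

/-- `μ` is carried by its atoms. -/
def IsPurelyAtomic {X : Type*} [MeasurableSpace X] (μ : Measure X) : Prop :=
  ∀ᵐ x ∂μ, μ {x} ≠ 0

lemma nullSingletonClass_of_map_val_absolutelyContinuous {X : Type*} [MeasurableSpace X] {s : Set X}
    {m : Measure s} {μ : Measure X} [NullSingletonClass μ] (hac : m.map Subtype.val ≪ μ) :
    NullSingletonClass m where
  measure_singleton z := by
    have hne : ∀ᵐ x : X ∂μ, x ≠ z := measure_eq_zero_iff_ae_notMem.1 (measure_singleton (z : X))
    exact measure_eq_zero_iff_ae_notMem.2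
      ((ae_subtype_of_ae hac hne).mono fun x hx hxz => hx (congrArg Subtype.val hxz))

section Cells

variable {F : Type*} [NormedAddCommGroup F] [InnerProductSpace ℝ F] {M : Set F}

/-- The points of `M` at which `z` is a maximizer in the definition of `legendre f`; up to a null
set, the preimage of `z` under the transport map `∇ (legendre f)`. -/
def contactSet (f : M →ᵇ ℝ) (z : M) : Set F :=
  {x | x ∈ M ∧ legendre f x = ⟪x, (z : F)⟫ - f z}

/-- The interior of the convex hull of `contactSet f z`; the transport map in the opposite
direction avoids it. -/
def openCell (f : M →ᵇ ℝ) (z : M) : Set F :=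
  interior (convexHull ℝ (contactSet f z))

lemma isOpen_preimage_openCell (f : M →ᵇ ℝ) (z : M) :
    IsOpen ((Subtype.val : M → F) ⁻¹' openCell f z) :=
  isOpen_interior.preimage continuous_subtype_val

section MaximumPoint

variable [CompleteSpace F] [CompactSpace M] [Nonempty M]

lemma brenierMap_mem_contactSet {f : M →ᵇ ℝ} {x : M}
    (hd : DifferentiableAt ℝ (legendre f) (x : F)) : (x : F) ∈ contactSet f (brenierMap f x) :=
  ⟨x.2, legendre_eq_brenierMap hd⟩

lemma convexHull_contactSet_subset {f : M →ᵇ ℝ} {y : M} (z : M)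
    (hd : DifferentiableAt ℝ (legendre (legendreOn f)) (y : F)) :
    convexHull ℝ (contactSet f z)
      ⊆ {x | ⟪(y : F) - z, x⟫ ≤ ⟪(y : F) - z, (brenierMap (legendreOn f) y : F)⟫} := by
  refine convexHull_min ?_ (convex_halfSpace_le (innerSL ℝ ((y : F) - z)).isLinear _)
  rintro x ⟨hxM, hx⟩
  have hy := inner_sub_le_legendre (legendreOn f) (y : F) ⟨x, hxM⟩
  have hz := inner_sub_le_legendre f (brenierMap (legendreOn f) y : F) z
  rw [legendre_eq_brenierMap hd, legendreOn_apply, legendreOn_apply, hx] at hy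
  rw [real_inner_comm] at hz
  simp only [Set.mem_ofPred_eq, inner_sub_left, real_inner_comm x (z : F)]
  linarith

/-- At an interior point of the cell the linear form `⟪y - z, ·⟫` would have a local maximum. -/
lemma brenierMap_legendreOn_notMem_openCell {f : M →ᵇ ℝ} {y z : M} (hyz : y ≠ z)
    (hd : DifferentiableAt ℝ (legendre (legendreOn f)) (y : F)) :
    (brenierMap (legendreOn f) y : F) ∉ openCell f z := fun hmem => by
  have hmax : IsLocalMax (innerSL ℝ ((y : F) - z)) (brenierMap (legendreOn f) y : F) :=
    mem_of_superset (mem_interior_iff_mem_nhds.1 hmem) (convexHull_contactSet_subset z hd)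
  have hzero := hmax.hasFDerivAt_eq_zero (innerSL ℝ ((y : F) - z)).hasFDerivAt
  have hinner : ⟪(y : F) - z, (y : F) - z⟫ = 0 := DFunLike.congr_fun hzero ((y : F) - z)
  exact hyz (Subtype.ext (sub_eq_zero.1 (inner_self_eq_zero.1 hinner)))

end MaximumPoint

variable [FiniteDimensional ℝ F] [MeasurableSpace F] [BorelSpace F] {m : Measure M}

lemma ae_mem_openCell (hac : m.map Subtype.val ≪ volume) (f : M →ᵇ ℝ) (z : M) :
    ∀ᵐ x : M ∂m, (x : F) ∈ contactSet f z → (x : F) ∈ openCell f z := by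
  have hfrontier : ∀ᵐ x : F, x ∉ frontier (convexHull ℝ (contactSet f z)) :=
    measure_eq_zero_iff_ae_notMem.1 ((convex_convexHull ℝ _).addHaar_frontier volume)
  filter_upwards [ae_subtype_of_ae hac hfrontier] with x hx hxc
  by_contra hcon
  exact hx ⟨subset_closure (subset_convexHull ℝ _ hxc), hcon⟩

variable [CompactSpace M] [Nonempty M] [IsProbabilityMeasure m]

lemma brenierMeasure_legendreOn_openCell [NullSingletonClass m] (hac : m.map Subtype.val ≪ volume)
    (f : M →ᵇ ℝ) (z : M) :
    (brenierMeasure m (legendreOn f) : Measure M) (Subtype.val ⁻¹' openCell f z) = 0 := by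
  refine (Measure.map_apply (measurable_brenierMap_of_compactSpace _)
    (isOpen_preimage_openCell f z).measurableSet).trans (measure_eq_zero_iff_ae_notMem.2 ?_)
  filter_upwards [ae_differentiableAt_legendre hac (legendreOn f),
    measure_eq_zero_iff_ae_notMem.1 (measure_singleton z)] with y hd hy
  exact brenierMap_legendreOn_notMem_openCell hy hd

theorem measure_support_brenierMeasure_legendreOn [NullSingletonClass m]
    (hac : m.map Subtype.val ≪ volume) {f : M →ᵇ ℝ}
    (hf : IsPurelyAtomic (brenierMeasure m f : Measure M)) :
    m (brenierMeasure m (legendreOn f) : Measure M).support = 0 := by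
  let μ : Measure M := brenierMeasure m f
  have hatoms : {z : M | 0 < μ {z}}.Countable :=
    Measure.countable_meas_pos_of_disjoint_iUnion (fun z => measurableSet_singleton z)
      fun _ _ => Set.disjoint_singleton.2
  have hatom : ∀ᵐ x : M ∂m, μ {brenierMap f x} ≠ 0 :=
    ae_of_ae_map (measurable_brenierMap_of_compactSpace f).aemeasurable hf
  refine measure_eq_zero_iff_ae_notMem.2 ?_
  filter_upwards [hatom, ae_differentiableAt_legendre hac f,
    (ae_ball_iff hatoms).2 fun z _ => ae_mem_openCell hac f z] with x hx hd hcell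
  exact Measure.subset_compl_support_of_isOpen (isOpen_preimage_openCell f (brenierMap f x))
    (brenierMeasure_legendreOn_openCell hac f _)
    (hcell _ (pos_iff_ne_zero.2 hx) (brenierMap_mem_contactSet hd))

theorem nullSingletonClass_brenierMeasure_legendreOn [NullSingletonClass m]
    (hac : m.map Subtype.val ≪ volume) {f : M →ᵇ ℝ} (hf : IsBiconjugate f)
    [(brenierMeasure m f : Measure M).IsOpenPosMeasure] :
    NullSingletonClass (brenierMeasure m (legendreOn f) : Measure M) where
  measure_singleton x := by
    have hnull := brenierMeasure_legendreOn_openCell hac (legendreOn f) x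
    rw [hf] at hnull
    have hempty := (isOpen_preimage_openCell (legendreOn f) x).measure_eq_zero_iff _ |>.1 hnull
    refine (Measure.map_apply (measurable_brenierMap_of_compactSpace _)
      (measurableSet_singleton x)).trans (measure_eq_zero_iff_ae_notMem.2 ?_)
    filter_upwards [ae_differentiableAt_legendre hac (legendreOn f),
      ae_mem_openCell hac (legendreOn f) x] with y hd hy hyx
    have hyx : brenierMap (legendreOn f) y = x := hyx
    exact Set.eq_empty_iff_forall_notMem.1 hempty y (hy (hyx ▸ brenierMap_mem_contactSet hd))

end Cells

section ConjugateMeasure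

variable {n : ℕ} {M : Set (E n)} [CompactSpace M] [Nonempty M] {m : Measure M}
  [IsProbabilityMeasure m] [NullSingletonClass m] {μ ν : ProbabilityMeasure M}

theorem IsConjugate.measure_support_eq_zero (hac : m.map Subtype.val ≪ volume)
    (h : IsConjugate m μ ν) (hμ : IsPurelyAtomic (μ : Measure M)) :
    m (ν : Measure M).support = 0 := by
  obtain ⟨f, -, rfl, rfl⟩ := (isConjugate_iff hac).1 h
  exact measure_support_brenierMeasure_legendreOn hac hμ

theorem IsConjugate.nullSingletonClass (hac : m.map Subtype.val ≪ volume) (h : IsConjugate m μ ν)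
    [(μ : Measure M).IsOpenPosMeasure] : NullSingletonClass (ν : Measure M) := by
  obtain ⟨f, hf, rfl, rfl⟩ := (isConjugate_iff hac).1 h
  exact nullSingletonClass_brenierMeasure_legendreOn hac hf

end ConjugateMeasure

lemma mutuallySingular_of_measure_support_eq_zero {X : Type*} [TopologicalSpace X]
    [HereditarilyLindelofSpace X] [MeasurableSpace X] [OpensMeasurableSpace X] {μ ν : Measure X}
    (h : ν μ.support = 0) : μ.MutuallySingular ν :=
  ⟨μ.supportᶜ, Measure.isOpen_compl_support.measurableSet, Measure.measure_compl_support,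
    by rwa [compl_compl]⟩

/-! ### Random measures that are almost surely purely atomic -/

section PurelyAtomic

variable {X : Type*} [MeasurableSpace X]

/-- The total `ν`-mass of those fibres of `q` whose mass is less than `ε`. For finer and finer
partitions of `X` into fibres it controls the diffuse part of `ν`. -/
def smallFiberMass {ι : Type*} [Fintype ι] (q : X → ι) (ε : ℝ≥0∞) (ν : Measure X) : ℝ≥0∞ :=
  ∑ i, (Set.Iio ε).indicator id (ν (q ⁻¹' {i}))

lemma measure_setOf_fiber_lt_le {ι : Type*} [Fintype ι] (ν : Measure X) (q : X → ι) (ε : ℝ≥0∞) :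
    ν {x | ν (q ⁻¹' {q x}) < ε} ≤ smallFiberMass q ε ν := by
  classical
  have hsub : {x | ν (q ⁻¹' {q x}) < ε} ⊆ ⋃ i ∈ Finset.univ.filter
      (fun i => ν (q ⁻¹' {i}) < ε), q ⁻¹' {i} := fun x hx =>
    Set.mem_biUnion (Finset.mem_filter.2 ⟨Finset.mem_univ (q x), hx⟩) rfl
  calc ν {x | ν (q ⁻¹' {q x}) < ε}
      ≤ ∑ i ∈ Finset.univ.filter (fun i => ν (q ⁻¹' {i}) < ε), ν (q ⁻¹' {i}) :=
        (measure_mono hsub).trans (measure_biUnion_finset_le _ _)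
    _ = smallFiberMass q ε ν := by
        simp only [Finset.sum_filter, smallFiberMass, Set.indicator_apply, Set.mem_Iio, id_eq]

/-- A point is not an atom exactly when the fibres through it eventually have mass less than `ε`,
for every `ε`. -/
lemma measure_setOf_singleton_eq_zero_le_liminf {f : X → ℕ → Bool} (hf : Measurable f)
    (hinj : Function.Injective f) {ε : ℝ≥0∞} (hε : 0 < ε) (ν : Measure X) [IsFiniteMeasure ν] :
    ν {x | ν {x} = 0}
      ≤ liminf (fun k => smallFiberMass (fun x (i : Fin k) => f x i) ε ν) atTop := by
  let P (k : ℕ) (x : X) : Set X := (fun y (i : Fin k) => f y i) ⁻¹' {fun i : Fin k => f x i}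
  have hmeas (k : ℕ) (x : X) : MeasurableSet (P k x) :=
    measurable_pi_lambda _ (fun i : Fin k => (measurable_pi_apply (i : ℕ)).comp hf)
      (measurableSet_singleton _)
  have hanti (x : X) : Antitone fun k => P k x := fun k l hkl y hy =>
    funext fun i => congrFun hy (Fin.castLE hkl i)
  have hinter (x : X) : ⋂ k, P k x = {x} :=
    Set.Subset.antisymm
      (fun y hy => hinj (funext fun i => congrFun (Set.mem_iInter.1 hy (i + 1)) (Fin.last i)))
      (Set.singleton_subset_iff.2 (Set.mem_iInter.2 fun _ => rfl))
  have hmono : Monotone fun k => {x | ν (P k x) < ε} := fun k l hkl x hx =>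
    (measure_mono (hanti x hkl)).trans_lt hx
  have hsub : {x | ν {x} = 0} ⊆ ⋃ k, {x | ν (P k x) < ε} := fun x hx => by
    have hlim := tendsto_measure_iInter_atTop (μ := ν)
      (fun k => (hmeas k x).nullMeasurableSet) (hanti x) ⟨0, measure_ne_top _ _⟩
    rw [hinter, show ν {x} = 0 from hx] at hlim
    exact Set.mem_iUnion.2 (hlim.eventually_lt_const hε).exists
  calc ν {x | ν {x} = 0} ≤ ν (⋃ k, {x | ν (P k x) < ε}) := measure_mono hsub
    _ = liminf (fun k => ν {x | ν (P k x) < ε}) atTop :=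
        (tendsto_measure_iUnion_atTop hmono).liminf_eq.symm
    _ ≤ _ := liminf_le_liminf (Eventually.of_forall fun k => measure_setOf_fiber_lt_le ν _ ε)

lemma ae_eq_zero_of_tendsto_lintegral {μ : Measure X} {g : X → ℝ≥0∞} {h : ℕ → X → ℝ≥0∞}
    (hmeas : ∀ j, Measurable (h j)) (hle : ∀ j x, g x ≤ h j x)
    (hlim : Tendsto (fun j => ∫⁻ x, h j x ∂μ) atTop (𝓝 0)) : g =ᵐ[μ] 0 := by
  have hzero : ∫⁻ x, ⨅ j, h j x ∂μ = 0 :=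
    nonpos_iff_eq_zero.1 (ge_of_tendsto' hlim fun j => lintegral_mono fun x => iInf_le _ j)
  filter_upwards [(lintegral_eq_zero_iff (Measurable.iInf hmeas)).1 hzero] with x hx
  exact nonpos_iff_eq_zero.1 ((le_iInf fun j => hle j x).trans_eq hx)

lemma measurable_apply {A : Set X} (hA : MeasurableSet A) :
    Measurable fun ν : ProbabilityMeasure X => (ν : Measure X) A :=
  (Measure.measurable_coe hA).comp measurable_subtype_coe

lemma measurable_indicator_Iio_apply {A : Set X} (hA : MeasurableSet A) (ε : ℝ≥0∞) :
    Measurable fun ν : ProbabilityMeasure X => (Set.Iio ε).indicator id ((ν : Measure X) A) :=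
  (measurable_id.indicator measurableSet_Iio).comp (measurable_apply hA)

variable {m : Measure X} {Q : Measure (ProbabilityMeasure X)}

section SmallFiberMass

variable {ι : Type*} [Fintype ι] [MeasurableSpace ι] [MeasurableSingletonClass ι] {q : X → ι}

lemma measurable_smallFiberMass (hq : Measurable q) (ε : ℝ≥0∞) :
    Measurable fun ν : ProbabilityMeasure X => smallFiberMass q ε (ν : Measure X) :=
  Finset.measurable_fun_sum _ fun i _ =>
    measurable_indicator_Iio_apply (hq (measurableSet_singleton i)) ε

lemma lintegral_smallFiberMass_le (hq : Measurable q) {ε c : ℝ≥0∞}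
    (h : ∀ A, MeasurableSet A → ∫⁻ ν : ProbabilityMeasure X,
      (Set.Iio ε).indicator id ((ν : Measure X) A) ∂Q ≤ c * m A) :
    ∫⁻ ν : ProbabilityMeasure X, smallFiberMass q ε (ν : Measure X) ∂Q ≤ c * m Set.univ := by
  have hfiber (i : ι) : MeasurableSet (q ⁻¹' {i}) := hq (measurableSet_singleton i)
  calc ∫⁻ ν : ProbabilityMeasure X, smallFiberMass q ε (ν : Measure X) ∂Q
      = ∑ i, ∫⁻ ν : ProbabilityMeasure X,
          (Set.Iio ε).indicator id ((ν : Measure X) (q ⁻¹' {i})) ∂Q :=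
        lintegral_finsetSum _ fun i _ => measurable_indicator_Iio_apply (hfiber i) ε
    _ ≤ ∑ i, c * m (q ⁻¹' {i}) := Finset.sum_le_sum fun i _ => h _ (hfiber i)
    _ = c * m Set.univ := by
        rw [← Finset.mul_sum, sum_measure_preimage_singleton _ fun i _ => hfiber i,
          Finset.coe_univ, Set.preimage_univ]

end SmallFiberMass

theorem ae_isPurelyAtomic [MeasurableSpace.CountablySeparated X] [IsFiniteMeasure m]
    {ε c : ℕ → ℝ≥0∞} (hε : ∀ j, 0 < ε j) (hc : Tendsto c atTop (𝓝 0))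
    (h : ∀ j A, MeasurableSet A → ∫⁻ ν : ProbabilityMeasure X,
      (Set.Iio (ε j)).indicator id ((ν : Measure X) A) ∂Q ≤ c j * m A) :
    ∀ᵐ ν : ProbabilityMeasure X ∂Q, IsPurelyAtomic (ν : Measure X) := by
  obtain ⟨f, hf, hinj⟩ := MeasurableSpace.measurable_injection_nat_bool_of_countablySeparated X
  have hq (k : ℕ) : Measurable fun x (i : Fin k) => f x i :=
    measurable_pi_lambda _ fun i => (measurable_pi_apply (i : ℕ)).comp hf
  have hbound (j : ℕ) : ∫⁻ ν : ProbabilityMeasure X, liminf (fun k =>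
      smallFiberMass (fun x (i : Fin k) => f x i) (ε j) (ν : Measure X)) atTop ∂Q
        ≤ c j * m Set.univ :=
    (lintegral_liminf_le fun k => measurable_smallFiberMass (hq k) (ε j)).trans
      ((liminf_le_liminf (Eventually.of_forall fun k =>
        lintegral_smallFiberMass_le (hq k) (h j))).trans_eq (liminf_const _))
  have hlim : Tendsto (fun j => c j * m Set.univ) atTop (𝓝 0) := by
    simpa only [zero_mul] using ENNReal.Tendsto.mul_const hc (Or.inr (measure_ne_top m _))
  have hzero := ae_eq_zero_of_tendsto_lintegral (μ := Q)
    (g := fun ν => (ν : Measure X) {x | (ν : Measure X) {x} = 0})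
    (fun j => Measurable.liminf fun k => measurable_smallFiberMass (hq k) (ε j))
    (fun j ν => measure_setOf_singleton_eq_zero_le_liminf hf hinj (hε j) ν)
    (tendsto_of_tendsto_of_tendsto_of_le_of_le tendsto_const_nhds hlim
      (fun _ => zero_le) hbound)
  filter_upwards [hzero] with ν hν
  exact measure_eq_zero_iff_ae_notMem.1 hν

end PurelyAtomic

/-! ### Two-block marginals of the Dirichlet–Ferguson process -/

section Beta

open ProbabilityTheory

lemma measurable_simplexPoint (N : ℕ) :
    Measurable (simplexPoint : (Fin N → ℝ) → Fin (N + 1) → ℝ) := by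
  refine measurable_pi_iff.2 (Fin.lastCases ?_ fun j => ?_)
  · simp only [simplexPoint, Fin.snoc_last]
    fun_prop
  · simp only [simplexPoint, Fin.snoc_castSucc]
    fun_prop

lemma simplexPoint_fin_one_zero (x : Fin 1 → ℝ) : simplexPoint x 0 = x 0 :=
  Fin.snoc_castSucc (α := fun _ => ℝ) (1 - ∑ i, x i) x 0

lemma simplexPoint_fin_one_one (x : Fin 1 → ℝ) : simplexPoint x 1 = 1 - x 0 :=
  (Fin.snoc_last (α := fun _ => ℝ) (1 - ∑ i, x i) x).trans (by rw [Fin.sum_univ_one])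

lemma dirichletDensity_fin_one (α : Fin 2 → ℝ) (x : Fin 1 → ℝ) :
    ({x : Fin 1 → ℝ | ∀ i, 0 < simplexPoint x i}.indicator fun x =>
      ENNReal.ofReal (Real.Gamma (∑ i, α i) / (∏ i, Real.Gamma (α i)) *
        ∏ i, simplexPoint x i ^ (α i - 1))) x = betaPDF (α 0) (α 1) (x 0) := by
  have hmem : (∀ i, 0 < simplexPoint x i) ↔ 0 < x 0 ∧ x 0 < 1 := by
    refine Fin.forall_fin_two.trans ?_
    rw [simplexPoint_fin_one_zero, simplexPoint_fin_one_one, sub_pos]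
  have hprod : ∏ i, simplexPoint x i ^ (α i - 1)
      = x 0 ^ (α 0 - 1) * (1 - x 0) ^ (α 1 - 1) := by
    refine (Fin.prod_univ_two _).trans ?_
    rw [simplexPoint_fin_one_zero, simplexPoint_fin_one_one]
  simp only [Set.indicator_apply, Set.mem_ofPred_eq, hmem, hprod, betaPDF_eq, beta, one_div_div,
    Fin.sum_univ_two, Fin.prod_univ_two, mul_assoc, apply_ite ENNReal.ofReal, ENNReal.ofReal_zero]

theorem map_dirichletMeasure_two (α : Fin 2 → ℝ) :
    (dirichletMeasure α).map (fun p => p 0) = betaMeasure (α 0) (α 1) := by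
  have hcoord : (fun p : Fin 2 → ℝ => p 0) ∘ simplexPoint = MeasurableEquiv.funUnique (Fin 1) ℝ :=
    funext simplexPoint_fin_one_zero
  rw [dirichletMeasure, funext (dirichletDensity_fin_one α),
    Measure.map_map (measurable_pi_apply 0) (measurable_simplexPoint 1), hcoord]
  ext A hA
  rw [MeasurableEquiv.map_apply, withDensity_apply _ (MeasurableEquiv.measurable _ hA),
    betaMeasure, withDensity_apply _ hA]
  exact (volume_preserving_funUnique (Fin 1) ℝ).setLIntegral_comp_preimage hA
    (measurable_betaPDFReal _ _).ennreal_ofReal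

lemma exists_inv_Gamma_le : ∃ c : ℝ, 0 < c ∧ ∀ s, 0 < s → (Real.Gamma s)⁻¹ ≤ c * s := by
  obtain ⟨t, ht, hmin⟩ := Real.exists_isMinOn_Gamma_Ioi
  have hpos : 0 < Real.Gamma t := Real.Gamma_pos_of_pos (one_pos.trans ht.1)
  refine ⟨(Real.Gamma t)⁻¹, inv_pos.2 hpos, fun s hs => ?_⟩
  have hle : Real.Gamma t ≤ s * Real.Gamma s :=
    (Real.Gamma_add_one hs.ne').symm ▸ hmin (Set.mem_Ioi.2 (by positivity))
  rw [inv_mul_eq_div, le_div_iff₀ hpos, inv_mul_le_iff₀ (Real.Gamma_pos_of_pos hs), mul_comm]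
  exact hle

lemma rpow_sub_one_mul_self_mul_le {a b t : ℝ} (ha : 0 < a) (hb : 0 < b) (ht : 0 < t)
    (ht' : t ≤ 1 / 2) : t ^ (a - 1) * t * (1 - t) ^ (b - 1) ≤ 2 := by
  have hleft : t ^ (a - 1) * t ≤ 1 := by
    rw [← Real.rpow_add_one ht.ne', sub_add_cancel]
    exact Real.rpow_le_one ht.le (by linarith) ha.le
  have hright : (1 - t) ^ (b - 1) ≤ 2 := by
    rw [Real.rpow_sub_one (by linarith), div_le_iff₀ (by linarith)]
    linarith [Real.rpow_le_one (x := 1 - t) (by linarith) (by linarith) hb.le]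
  have hnonneg : 0 ≤ (1 - t) ^ (b - 1) := Real.rpow_nonneg (by linarith) _
  linarith [mul_le_mul hleft hright hnonneg zero_le_one]

lemma exists_betaPDFReal_mul_self_le {β : ℝ} (hβ : 0 < β) :
    ∃ K : ℝ, 0 ≤ K ∧ ∀ a b, 0 < a → 0 < b → a + b = β → ∀ t, 0 < t → t ≤ 1 / 2 →
      betaPDFReal a b t * t ≤ K * a := by
  obtain ⟨c, hc, hΓ⟩ := exists_inv_Gamma_le
  have : 0 < Real.Gamma β := Real.Gamma_pos_of_pos hβ
  refine ⟨Real.Gamma β * (c * (c * β)) * 2, by positivity, fun a b ha hb hab t ht ht' => ?_⟩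
  have hΓb : (Real.Gamma b)⁻¹ ≤ c * β :=
    (hΓ b hb).trans (mul_le_mul_of_nonneg_left (by linarith) hc.le)
  have : 0 < Real.Gamma a := Real.Gamma_pos_of_pos ha
  have : 0 < Real.Gamma b := Real.Gamma_pos_of_pos hb
  have hpow : 0 ≤ t ^ (a - 1) * t * (1 - t) ^ (b - 1) :=
    mul_nonneg (by positivity) (Real.rpow_nonneg (by linarith) _)
  calc betaPDFReal a b t * t
      = Real.Gamma β * ((Real.Gamma a)⁻¹ * (Real.Gamma b)⁻¹)
        * (t ^ (a - 1) * t * (1 - t) ^ (b - 1)) := by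
        rw [betaPDFReal, if_pos ⟨ht, by linarith⟩, beta, hab, one_div_div, div_eq_mul_inv, mul_inv]
        ring
    _ ≤ Real.Gamma β * (c * a * (c * β)) * 2 := by
        gcongr
        · exact hΓ a ha
        · exact rpow_sub_one_mul_self_mul_le ha hb ht ht'
    _ = Real.Gamma β * (c * (c * β)) * 2 * a := by ring

lemma exists_lintegral_betaMeasure_le {β : ℝ} (hβ : 0 < β) :
    ∃ K : ℝ≥0, ∀ a b, 0 < a → 0 < b → a + b = β → ∀ ε : ℝ≥0∞, ε ≤ 2⁻¹ →
      ∫⁻ t, (Set.Iio ε).indicator id (ENNReal.ofReal t) ∂betaMeasure a b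
        ≤ K * ε * ENNReal.ofReal a := by
  obtain ⟨K, hK, hle⟩ := exists_betaPDFReal_mul_self_le hβ
  refine ⟨K.toNNReal, fun a b ha hb hab ε hε => ?_⟩
  have hε_top : ε ≠ ∞ := ne_top_of_le_ne_top (by simp) hε
  have hpointwise (t : ℝ) : betaPDF a b t * (Set.Iio ε).indicator id (ENNReal.ofReal t)
      ≤ (Set.Ioo 0 ε.toReal).indicator (fun _ => ENNReal.ofReal (K * a)) t := by
    rcases le_or_gt t 0 with ht | ht
    · rw [betaPDF_eq_zero_of_nonpos ht, zero_mul]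
      exact zero_le
    by_cases htε : ENNReal.ofReal t < ε
    · have hlt : t < ε.toReal := (ENNReal.ofReal_lt_iff_lt_toReal ht.le hε_top).1 htε
      have hhalf : ε.toReal ≤ 1 / 2 := by simpa using ENNReal.toReal_mono (by simp) hε
      rw [Set.indicator_of_mem (Set.mem_Iio.2 htε), Set.indicator_of_mem (Set.mem_Ioo.2 ⟨ht, hlt⟩),
        id_eq, betaPDF, ← ENNReal.ofReal_mul' ht.le]
      exact ENNReal.ofReal_le_ofReal (hle a b ha hb hab t ht (hlt.le.trans hhalf))
    · rw [Set.indicator_of_notMem (mt Set.mem_Iio.1 htε), mul_zero]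
      exact zero_le
  have hmeas : Measurable fun t : ℝ => (Set.Iio ε).indicator id (ENNReal.ofReal t) :=
    (measurable_id.indicator measurableSet_Iio).comp ENNReal.measurable_ofReal
  calc ∫⁻ t, (Set.Iio ε).indicator id (ENNReal.ofReal t) ∂betaMeasure a b
      = ∫⁻ t, betaPDF a b t * (Set.Iio ε).indicator id (ENNReal.ofReal t) :=
        lintegral_withDensity_eq_lintegral_mul _ (measurable_betaPDFReal a b).ennreal_ofReal hmeas
    _ ≤ ∫⁻ t, (Set.Ioo 0 ε.toReal).indicator (fun _ => ENNReal.ofReal (K * a)) t :=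
        lintegral_mono hpointwise
    _ = ENNReal.ofReal (K * a) * ε := by
        rw [lintegral_indicator_const measurableSet_Ioo, Real.volume_Ioo, sub_zero,
          ENNReal.ofReal_toReal hε_top]
    _ = K.toNNReal * ε * ENNReal.ofReal a := by
        rw [ENNReal.ofReal_mul hK, mul_right_comm]
        rfl

end Beta

section DirichletFerguson

open ProbabilityTheory

variable {X : Type*} [MeasurableSpace X] {m : Measure X} {β : ℝ}
  {Q : Measure (ProbabilityMeasure X)} {A : Set X}

lemma measurable_real_apply (hA : MeasurableSet A) :
    Measurable fun ν : ProbabilityMeasure X => (ν : Measure X).real A :=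
  (measurable_apply hA).ennreal_toReal

theorem IsDirichletFerguson.map_real_apply (hQ : IsDirichletFerguson m β Q)
    (hA : MeasurableSet A) (hmA : 0 < m A) (hmAc : 0 < m Aᶜ) :
    Q.map (fun ν : ProbabilityMeasure X => (ν : Measure X).real A)
      = betaMeasure (β * m.real A) (β * m.real Aᶜ) := by
  let B : Fin 2 → Set X := ![A, Aᶜ]
  have hB : ∀ i, MeasurableSet (B i) := Fin.forall_fin_two.2 ⟨hA, hA.compl⟩
  have hdisj : Pairwise (Function.onFun Disjoint B) :=
    pairwise_fin_succ_iff.2 ⟨Fin.forall_fin_one.2 disjoint_compl_left,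
      Fin.forall_fin_one.2 disjoint_compl_right, Subsingleton.pairwise⟩
  have hcover : ⋃ i, B i = Set.univ := Set.eq_univ_of_forall fun x =>
    Set.mem_iUnion.2 (Fin.exists_fin_two.2 (Classical.em (x ∈ A)))
  have hlaw := congrArg (Measure.map fun p : Fin 2 → ℝ => p 0)
    (hQ.map_eq 1 B hB hdisj hcover (Fin.forall_fin_two.2 ⟨hmA, hmAc⟩))
  rw [map_dirichletMeasure_two, Measure.map_map (measurable_pi_apply 0)
    (measurable_pi_iff.2 fun i => measurable_real_apply (hB i))] at hlaw
  exact hlaw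

theorem IsDirichletFerguson.lintegral_apply (hQ : IsDirichletFerguson m β Q)
    (hA : MeasurableSet A) (hmA : 0 < m A) (hmAc : 0 < m Aᶜ) {g : ℝ≥0∞ → ℝ≥0∞}
    (hg : Measurable g) :
    ∫⁻ ν : ProbabilityMeasure X, g ((ν : Measure X) A) ∂Q
      = ∫⁻ t, g (ENNReal.ofReal t) ∂betaMeasure (β * m.real A) (β * m.real Aᶜ) := by
  rw [← hQ.map_real_apply hA hmA hmAc, lintegral_map (f := fun t => g (ENNReal.ofReal t))
    (hg.comp ENNReal.measurable_ofReal) (measurable_real_apply hA)]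
  exact lintegral_congr fun ν => by rw [ofReal_measureReal]

lemma IsDirichletFerguson.lintegral_apply_congr (hQ : IsDirichletFerguson m β Q) {B : Set X}
    (hA : MeasurableSet A) (hB : MeasurableSet B) (hAB : A =ᵐ[m] B) (hmB : 0 < m B)
    (hmBc : 0 < m Bᶜ) :
    ∫⁻ ν : ProbabilityMeasure X, (ν : Measure X) A ∂Q
      = ∫⁻ ν : ProbabilityMeasure X, (ν : Measure X) B ∂Q := by
  have hmA : 0 < m A := (measure_congr hAB).symm ▸ hmB
  have hmAc : 0 < m Aᶜ := (measure_congr hAB.compl).symm ▸ hmBc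
  have hintA := hQ.lintegral_apply hA hmA hmAc measurable_id
  rw [measureReal_congr hAB, measureReal_congr hAB.compl] at hintA
  exact hintA.trans (hQ.lintegral_apply hB hmB hmBc measurable_id).symm

/-- The definition of the process says nothing directly about an `m`-null set `A`; but `B \ A` and
`B ∪ A` have the same expected mass, for any `B` with `m B` and `m Bᶜ` positive. -/
lemma IsDirichletFerguson.ae_apply_eq_zero (hQ : IsDirichletFerguson m β Q)
    (hm : ∃ B, MeasurableSet B ∧ 0 < m B ∧ 0 < m Bᶜ) (hA : MeasurableSet A) (hmA : m A = 0) :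
    ∀ᵐ ν : ProbabilityMeasure X ∂Q, (ν : Measure X) A = 0 := by
  have := hQ.isProbabilityMeasure
  obtain ⟨B, hB, hmB, hmBc⟩ := hm
  have hdiff : (B \ A : Set X) =ᵐ[m] B := sdiff_null_ae_eq_self hmA
  have hunion : (B ∪ A : Set X) =ᵐ[m] B := union_ae_eq_left_of_ae_eq_empty (ae_eq_empty.2 hmA)
  have hle (ν : ProbabilityMeasure X) : (ν : Measure X) (B \ A) ≤ (ν : Measure X) (B ∪ A) :=
    measure_mono (Set.sdiff_subset.trans Set.subset_union_left)
  have hfin : ∫⁻ ν : ProbabilityMeasure X, (ν : Measure X) (B \ A) ∂Q ≠ ∞ :=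
    ne_top_of_le_ne_top (by simp) (lintegral_mono fun ν : ProbabilityMeasure X =>
      (prob_le_one : (ν : Measure X) (B \ A) ≤ 1))
  have hint := (hQ.lintegral_apply_congr (hB.union hA) hB hunion hmB hmBc).trans
    (hQ.lintegral_apply_congr (hB.diff hA) hB hdiff hmB hmBc).symm
  filter_upwards [ae_eq_of_ae_le_of_lintegral_le (ae_of_all _ hle) hfin
    (measurable_apply (hB.union hA)).aemeasurable hint.le] with ν hν
  rw [← Set.sdiff_union_self, measure_union Set.disjoint_sdiff_left hA] at hν
  exact (ENNReal.add_right_inj (measure_ne_top _ _)).1 (hν.symm.trans (add_zero _).symm)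

lemma IsDirichletFerguson.ae_apply_ne_zero (hQ : IsDirichletFerguson m β Q)
    (hm : ∃ B, MeasurableSet B ∧ 0 < m B ∧ 0 < m Bᶜ) (hA : MeasurableSet A) (hmA : 0 < m A) :
    ∀ᵐ ν : ProbabilityMeasure X ∂Q, (ν : Measure X) A ≠ 0 := by
  rcases eq_or_ne (m Aᶜ) 0 with hmAc | hmAc
  · filter_upwards [hQ.ae_apply_eq_zero hm hA.compl hmAc] with ν hν
    rw [(prob_compl_eq_zero_iff hA).1 hν]
    exact one_ne_zero
  · have hlaw := hQ.map_real_apply hA hmA (pos_iff_ne_zero.2 hmAc)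
    have hne : ∀ᵐ t ∂Q.map (fun ν : ProbabilityMeasure X => (ν : Measure X).real A), t ≠ 0 := by
      rw [hlaw]
      exact (withDensity_absolutelyContinuous _ _).ae_le (Measure.ae_ne volume 0)
    filter_upwards [ae_of_ae_map (measurable_real_apply hA).aemeasurable hne] with ν hν hzero
    exact hν (by rw [measureReal_def, hzero, ENNReal.toReal_zero])

lemma IsDirichletFerguson.exists_lintegral_small_le [IsFiniteMeasure m] (hβ : 0 < β)
    (hQ : IsDirichletFerguson m β Q) (hm : ∃ B, MeasurableSet B ∧ 0 < m B ∧ 0 < m Bᶜ) :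
    ∃ K : ℝ≥0, ∀ ε ≤ 2⁻¹, ∀ A, MeasurableSet A → ∫⁻ ν : ProbabilityMeasure X,
      (Set.Iio ε).indicator id ((ν : Measure X) A) ∂Q ≤ K * ε * m A := by
  have hreal {A : Set X} (hmA : m A ≠ 0) : 0 < β * m.real A :=
    mul_pos hβ (ENNReal.toReal_pos hmA (measure_ne_top m A))
  have huniv : m Set.univ ≠ 0 :=
    hm.elim fun B hB => (hB.2.1.trans_le (measure_mono (Set.subset_univ B))).ne'
  obtain ⟨K, hK⟩ := exists_lintegral_betaMeasure_le (hreal huniv)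
  refine ⟨K * β.toNNReal, fun ε hε A hA => ?_⟩
  rcases eq_or_ne (m A) 0 with hmA | hmA
  · refine (lintegral_eq_zero_of_ae_eq_zero ?_).trans_le zero_le
    filter_upwards [hQ.ae_apply_eq_zero hm hA hmA] with ν hν
    rw [hν]
    exact Set.indicator_apply_eq_zero.2 fun _ => rfl
  rcases eq_or_ne (m Aᶜ) 0 with hmAc | hmAc
  · refine (lintegral_eq_zero_of_ae_eq_zero ?_).trans_le zero_le
    filter_upwards [hQ.ae_apply_eq_zero hm hA.compl hmAc] with ν hν
    have hε_one : ε ≤ 1 := hε.trans (ENNReal.inv_le_one.2 one_le_two)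
    rw [(prob_compl_eq_zero_iff hA).1 hν, Set.indicator_of_notMem (Set.notMem_Iio.2 hε_one),
      Pi.zero_apply]
  calc ∫⁻ ν : ProbabilityMeasure X, (Set.Iio ε).indicator id ((ν : Measure X) A) ∂Q
      = ∫⁻ t, (Set.Iio ε).indicator id (ENNReal.ofReal t)
          ∂betaMeasure (β * m.real A) (β * m.real Aᶜ) :=
        hQ.lintegral_apply hA (pos_iff_ne_zero.2 hmA) (pos_iff_ne_zero.2 hmAc)
          (measurable_id.indicator measurableSet_Iio)
    _ ≤ K * ε * ENNReal.ofReal (β * m.real A) :=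
        hK _ _ (hreal hmA) (hreal hmAc)
          (by rw [← mul_add, measureReal_add_measureReal_compl hA]) ε hε
    _ = (K * β.toNNReal : ℝ≥0) * ε * m A := by
        rw [ENNReal.ofReal_mul hβ.le, ofReal_measureReal, ENNReal.coe_mul, ENNReal.ofReal]
        ring

theorem IsDirichletFerguson.ae_isPurelyAtomic [MeasurableSpace.CountablySeparated X]
    [IsFiniteMeasure m] (hβ : 0 < β) (hQ : IsDirichletFerguson m β Q)
    (hm : ∃ B, MeasurableSet B ∧ 0 < m B ∧ 0 < m Bᶜ) :
    ∀ᵐ ν : ProbabilityMeasure X ∂Q, IsPurelyAtomic (ν : Measure X) := by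
  obtain ⟨K, hK⟩ := hQ.exists_lintegral_small_le hβ hm
  let ε (j : ℕ) : ℝ≥0∞ := ((j + 2 : ℕ) : ℝ≥0∞)⁻¹
  have hε_half (j : ℕ) : ε j ≤ 2⁻¹ :=
    ENNReal.inv_le_inv.2 (by exact_mod_cast Nat.le_add_left 2 j)
  have hε_lim : Tendsto (fun j => K * ε j) atTop (𝓝 0) := by
    simpa only [mul_zero, Function.comp_def] using ENNReal.Tendsto.const_mul
      (ENNReal.tendsto_inv_nat_nhds_zero.comp (tendsto_add_atTop_nat 2))
      (Or.inr (ENNReal.coe_ne_top (r := K)))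
  exact Entropic.ae_isPurelyAtomic (fun j => ENNReal.inv_pos.2 (ENNReal.natCast_ne_top _)) hε_lim
    fun j A hA => hK (ε j) (hε_half j) A hA

theorem IsDirichletFerguson.ae_isOpenPosMeasure [TopologicalSpace X] [SecondCountableTopology X]
    [OpensMeasurableSpace X] [m.IsOpenPosMeasure] (hQ : IsDirichletFerguson m β Q)
    (hm : ∃ B, MeasurableSet B ∧ 0 < m B ∧ 0 < m Bᶜ) :
    ∀ᵐ ν : ProbabilityMeasure X ∂Q, (ν : Measure X).IsOpenPosMeasure := by
  have hbasis := TopologicalSpace.isBasis_countableBasis X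
  have hne := (ae_ball_iff (μ := Q) (TopologicalSpace.countable_countableBasis X)).2
    fun U hU => hQ.ae_apply_ne_zero hm (hbasis.isOpen hU).measurableSet
      ((hbasis.isOpen hU).measure_pos m (TopologicalSpace.nonempty_of_mem_countableBasis hU))
  filter_upwards [hne] with ν hν
  refine ⟨fun U hU ⟨x, hx⟩ hzero => ?_⟩
  obtain ⟨V, hV, -, hVU⟩ := hbasis.exists_subset_of_mem_open hx hU
  exact hν V hV (measure_mono_null hVU hzero)

end DirichletFerguson

section OpenPosMeasure

variable {X : Type*} [TopologicalSpace X] [MeasurableSpace X] {m : Measure X}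

lemma isOpenPosMeasure_of_support_eq_univ (h : m.support = Set.univ) : m.IsOpenPosMeasure where
  open_pos U hU hne := by
    obtain ⟨x, hx⟩ := hne
    have hmem : x ∈ m.support := h ▸ Set.mem_univ x
    exact ((Measure.mem_support_iff_forall x).1 hmem U (hU.mem_nhds hx)).ne'

lemma exists_measure_pos_and_compl_pos [T2Space X] [OpensMeasurableSpace X] [NeZero m]
    [NullSingletonClass m] [m.IsOpenPosMeasure] : ∃ B, MeasurableSet B ∧ 0 < m B ∧ 0 < m Bᶜ := by
  have : Nontrivial X := by
    by_contra hcon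
    rw [not_nontrivial_iff_subsingleton] at hcon
    exact NeZero.ne m (Measure.measure_univ_eq_zero.1 (Set.subsingleton_univ.measure_zero m))
  obtain ⟨x, y, hxy⟩ := exists_pair_ne X
  obtain ⟨U, V, hU, hV, hxU, hyV, hUV⟩ := t2_separation hxy
  exact ⟨U, hU.measurableSet, hU.measure_pos m ⟨x, hxU⟩,
    (hV.measure_pos m ⟨y, hyV⟩).trans_le (measure_mono hUV.subset_compl_left)⟩

end OpenPosMeasure

/-! ### The entropic measure -/

section EntropicMeasure

variable {n : ℕ} {M : Set (E n)} [CompactSpace M] [Nonempty M] {m : Measure M}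
  [IsProbabilityMeasure m] [m.IsOpenPosMeasure] {Q : Measure (ProbabilityMeasure M)}

lemma measurableEmbedding_conj (hac : m.map Subtype.val ≪ volume) (hm : IsIrreducible m) :
    MeasurableEmbedding (conj m) := by
  have : BorelSpace (ProbabilityMeasure M) := borelSpace_probabilityMeasure
  exact (MeasurableEquiv.ofInvolutive (conj m) (conj_involutive hac hm)
    (continuous_conj hac hm).measurable).measurableEmbedding

theorem IsDirichletFerguson.ae_conj [NullSingletonClass m] {β : ℝ}
    (hQ : IsDirichletFerguson m β Q) (hβ : 0 < β) (hac : m.map Subtype.val ≪ volume) :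
    ∀ᵐ ν ∂Q, NullSingletonClass (conj m ν : Measure M) ∧ m (conj m ν : Measure M).support = 0 := by
  have hsplit := exists_measure_pos_and_compl_pos (m := m)
  filter_upwards [hQ.ae_isPurelyAtomic hβ hsplit, hQ.ae_isOpenPosMeasure hsplit]
    with ν hatomic hopen
  have hconj := isConjugate_conj hac ν
  exact ⟨hconj.nullSingletonClass hac, hconj.measure_support_eq_zero hac hatomic⟩

end EntropicMeasure

end Entropic

end

theorem corollary6p2_general {n : ℕ} (hn : 0 < n) (M : Set (Entropic.E n)) (hM : IsCompact M)
    (m : Measure M) [IsProbabilityMeasure m] (hac : (m.map Subtype.val).AbsolutelyContinuous volume)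
    (hsupp : m.support = Set.univ) (hm : Entropic.IsIrreducible m) (β : ℝ) (hβ : 0 < β)
    (Q : Measure (ProbabilityMeasure M)) (hQ : Entropic.IsDirichletFerguson m β Q) :
    IsProbabilityMeasure (Entropic.entropicMeasure m Q) ∧
    (∀ᵐ μ : ProbabilityMeasure M ∂(Entropic.entropicMeasure m Q),
      (μ : Measure M).MutuallySingular m ∧
      (∀ x : M, (μ : Measure M) {x} = 0) ∧
      m (μ : Measure M).support = 0) ∧
    (∀ᵐ ν ∂Q, m (Entropic.conj m ν : Measure M).support = 0) := by
  have : CompactSpace M := isCompact_iff_compactSpace.1 hM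
  have : Nonempty M := nonempty_of_isProbabilityMeasure m
  have : Nonempty (Fin n) := Fin.pos_iff_nonempty.1 hn
  have : NullSingletonClass m := Entropic.nullSingletonClass_of_map_val_absolutelyContinuous hac
  have : m.IsOpenPosMeasure := Entropic.isOpenPosMeasure_of_support_eq_univ hsupp
  have : IsProbabilityMeasure Q := hQ.isProbabilityMeasure
  have hconj := Entropic.measurableEmbedding_conj hac hm
  have hae := hQ.ae_conj hβ hac
  refine ⟨Measure.isProbabilityMeasure_map hconj.measurable.aemeasurable,
    hconj.ae_map_iff.2 ?_, hae.mono fun ν hν => hν.2⟩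
  filter_upwards [hae] with ν ⟨hnull, hsupport⟩
  exact ⟨Entropic.mutuallySingular_of_measure_support_eq_zero hsupport,
    hnull.measure_singleton, hsupport⟩

theorem corollary6p2 {n : ℕ} (hn : 0 < n) (M : Set (Entropic.E n)) (hM : IsCompact M)
    (m : MeasureTheory.Measure M) [MeasureTheory.IsProbabilityMeasure m]
    (hac : (m.map Subtype.val).AbsolutelyContinuous MeasureTheory.volume)
    (hsupp : m.support = Set.univ)
    (hpoincare : Entropic.PoincareInequality m)
    (β : ℝ) (hβ : 0 < β)
    (Q : MeasureTheory.Measure (MeasureTheory.ProbabilityMeasure M))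
    (hQ : Entropic.IsDirichletFerguson m β Q) :
    MeasureTheory.IsProbabilityMeasure (Entropic.entropicMeasure m Q) ∧
    (∀ᵐ μ : MeasureTheory.ProbabilityMeasure M ∂(Entropic.entropicMeasure m Q),
      (μ : MeasureTheory.Measure M).MutuallySingular m ∧
      (∀ x : M, (μ : MeasureTheory.Measure M) {x} = 0) ∧
      m (μ : MeasureTheory.Measure M).support = 0) ∧
    (∀ᵐ ν ∂Q, m (Entropic.conj m ν : MeasureTheory.Measure M).support = 0) := by
  have : CompactSpace M := isCompact_iff_compactSpace.1 hM
  exact corollary6p2_general hn M hM m hac hsupp hpoincare.isIrreducible β hβ Q hQ
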